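/- Let $X$ be a complex analytic manifold of dimension $n$, let $D\subset X$ be a hypersurface (a closed subset which near each of its points is the zero set of a holomorphic function whose germ there is nonzero), and let $p\in D$. Let $\mathcal O=\mathcal O_{X,p}$ be the ring of germs at $p$ of holomorphic functions, $I_{D,p}\subset\mathcal O$ the ideal of germs vanishing on $D$, and $\mathrm{Der}(\log D)_p=\{\delta\in \mathrm{Der}_{\mathbb C}(\mathcal O)\mid \delta(I_{D,p})\subset I_{D,p}\}$ the $\mathcal O$-module of logarithmic derivations. Let $h$ be a reduced local equation of $D$ at $p$, i.e. a generator of $I_{D,p}$, and let $\mathrm{jac}(D)_p\subset\mathcal O$ be the ideal generated by $h$ and the $\delta(h)$, $\delta\in\mathrm{Der}_{\mathbb C}(\mathcal O)$ (equivalently, by $h$ and its partial derivatives in a system of local coordinates); it does not depend on $h$. Suppose that 1. $D$ is free at $p$, i.e. $\mathrm{Der}(\log D)_p$ is a free $\mathcal O$-module of rank $n$; and 2. $D$ is of linear jacobian type at $p$, i.e. the canonical map of $\mathcal O$-algebras from the symmetric algebra $\mathrm{Sym}_{\mathcal O}(\mathrm{jac}(D)_p)$ to the Rees algebra $\bigoplus_{d\ge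 0}\mathrm{jac}(D)_p^d\,t^d\subset\mathcal O[t]$ is an isomorphism. Then $D$ is Koszul free at $p$: for every basis $\delta_1,\dots,\delta_n$ of $\mathrm{Der}(\log D)_p$, the principal symbols $\sigma(\delta_1),\dots,\sigma(\delta_n)$ form a regular sequence in the graded ring $\mathrm{Gr}\,\mathcal D_{X,p}$ associated with the order filtration of the ring $\mathcal D_{X,p}$ of germs at $p$ of linear differential operators with holomorphic coefficients. -/

import Mathlib

open scoped Manifold ContDiff Topology

namespace LogGeom

noncomputable section

/-! ### Ideals of linear type -/

section LinearType

variable {A : Type*} [CommRing A]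

/-- The `A`-linear map `I → Rees(I) = ⨁ Iᵈ tᵈ`, `x ↦ x t`. -/
def toRees (I : Ideal A) : I →ₗ[A] reesAlgebra I where
  toFun x := ⟨Polynomial.monomial 1 (x : A), reesAlgebra.monomial_mem.2 (by simp)⟩
  map_add' x y := by ext1; simp
  map_smul' a x := by ext1; simp [Polynomial.smul_monomial]

/-- `I` is of linear type: the canonical morphism of `A`-algebras `Sym_A(I) → Rees(I)` is an
isomorphism. -/
def IsOfLinearType (I : Ideal A) : Prop :=
  Function.Bijective (SymmetricAlgebra.lift (toRees I))

end LinearType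

section Algebraic

variable (k : Type*) {A : Type*} [CommRing k] [CommRing A] [Algebra k A]

/-- The jacobian ideal of `f`: the ideal generated by `f` and all its derivatives `δ(f)`. -/
def jacobianIdeal (f : A) : Ideal A :=
  Ideal.span ({f} ∪ Set.range fun δ : Derivation k A A => δ f)

/-- It is enough to take the derivatives along a generating family of the module of derivations
(for instance along the partial derivatives of a coordinate system). -/
theorem jacobianIdeal_eq {ι : Type*} (d : ι → Derivation k A A)
    (hd : Submodule.span A (Set.range d) = ⊤) (f : A) :
    jacobianIdeal k f = Ideal.span ({f} ∪ Set.range fun i => d i f) := by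
  apply le_antisymm
  · refine Ideal.span_le.2 (Set.union_subset ?_ ?_)
    · exact fun x hx => Ideal.subset_span (Or.inl hx)
    · rintro _ ⟨δ, rfl⟩
      have hδ : δ ∈ Submodule.span A (Set.range d) := hd ▸ Submodule.mem_top
      change δ f ∈ Ideal.span ({f} ∪ Set.range fun i => d i f)
      induction hδ using Submodule.span_induction with
      | mem x hx =>
        obtain ⟨i, rfl⟩ := hx
        exact Ideal.subset_span (Or.inr ⟨i, rfl⟩)
      | zero => simp
      | add x y _ _ hx hy => simpa using add_mem hx hy
      | smul a x _ hx => simpa using Ideal.mul_mem_left _ a hx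
  · refine Ideal.span_mono (Set.union_subset_union_right _ ?_)
    rintro _ ⟨i, rfl⟩
    exact ⟨d i, rfl⟩

/-- `Der_k(log I)`: the module of `k`-derivations `δ` of `A` with `δ(I) ⊆ I`. -/
def logDer (I : Ideal A) : Submodule A (Derivation k A A) where
  carrier := {δ | ∀ a ∈ I, δ a ∈ I}
  add_mem' h₁ h₂ a ha := by simpa using add_mem (h₁ a ha) (h₂ a ha)
  zero_mem' a _ := by simp
  smul_mem' c δ h a ha := by simpa using Ideal.mul_mem_left _ c (h a ha)

end Algebraic

/-! ### Differential operators, the order filtration and its graded ring -/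

section DiffOps

set_option linter.unusedSimpArgs false

variable (k A : Type*) [CommRing k] [CommRing A] [Algebra k A]

/-- The operators of order `≤ 0`: multiplications by elements of `A`. -/
def mulOps : Submodule k (Module.End k A) :=
  LinearMap.range (LinearMap.mul k A)

/-- The operators of order `≤ 1`: the sums of a multiplication and a derivation. -/
def firstOps : Submodule k (Module.End k A) where
  carrier := {P | ∃ (a : A) (δ : Derivation k A A), P = LinearMap.mul k A a + (δ : A →ₗ[k] A)}
  add_mem' := by
    rintro _ _ ⟨a, δ, rfl⟩ ⟨b, ε, rfl⟩
    refine ⟨a + b, δ + ε, ?_⟩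
    ext x
    simp
    ring
  zero_mem' := ⟨0, 0, by ext x; simp⟩
  smul_mem' := by
    rintro c _ ⟨a, δ, rfl⟩
    refine ⟨c • a, c • δ, ?_⟩
    ext x
    simp

/-- The ring of linear differential operators of `A` over `k`: the algebra of operators generated by
the multiplications and the derivations. -/
def diffOps : Subalgebra k (Module.End k A) :=
  Algebra.adjoin k (firstOps k A)

/-- The order filtration `F⁰ ⊆ F¹ ⊆ ⋯` of the ring of linear differential operators of `A` over `k`:
`F⁰` consists of the multiplications, and `Fᵈ` is spanned by the products `L₁ ⋯ L_d a` with the `L_i`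
of order `≤ 1` and `a` in `A`. -/
def orderFil : ℕ → Submodule k (Module.End k A)
  | 0 => mulOps k A
  | d + 1 => firstOps k A * orderFil d

/-- The preceding step `Fᵈ⁻¹` of the filtration, with `F⁻¹ = 0`. -/
def orderFilLT : ℕ → Submodule k (Module.End k A)
  | 0 => ⊥
  | d + 1 => orderFil k A d

variable {k A}

theorem mulOps_le_firstOps : mulOps k A ≤ firstOps k A := by
  rintro _ ⟨a, rfl⟩
  exact ⟨a, 0, by ext x; simp⟩

theorem derivation_mem_firstOps (δ : Derivation k A A) : (δ : A →ₗ[k] A) ∈ firstOps k A :=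
  ⟨0, δ, by ext x; simp⟩

theorem one_mem_mulOps : (1 : Module.End k A) ∈ mulOps k A :=
  ⟨1, by ext x; simp⟩

theorem mulOps_mul_mulOps : mulOps k A * mulOps k A ≤ mulOps k A := by
  refine Submodule.mul_le.2 ?_
  rintro _ ⟨a, rfl⟩ _ ⟨b, rfl⟩
  exact ⟨a * b, by ext x; simp [mul_assoc]⟩

theorem mulOps_mul_firstOps : mulOps k A * firstOps k A ≤ firstOps k A := by
  refine Submodule.mul_le.2 ?_
  rintro _ ⟨a, rfl⟩ _ ⟨b, δ, rfl⟩
  exact ⟨a * b, a • δ, by ext x; simp [mul_assoc, mul_add]⟩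

theorem firstOps_mul_mulOps : firstOps k A * mulOps k A ≤ firstOps k A := by
  refine Submodule.mul_le.2 ?_
  rintro _ ⟨b, δ, rfl⟩ _ ⟨a, rfl⟩
  refine ⟨b * a + δ a, a • δ, ?_⟩
  ext x
  simp
  ring

theorem orderFil_mul_mulOps (i : ℕ) : orderFil k A i * mulOps k A ≤ orderFil k A i := by
  induction i with
  | zero => exact mulOps_mul_mulOps
  | succ i ih =>
    simp only [orderFil, mul_assoc]
    exact mul_le_mul_right ih _

theorem mulOps_mul_orderFil (i : ℕ) : mulOps k A * orderFil k A i ≤ orderFil k A i := by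
  cases i with
  | zero => exact mulOps_mul_mulOps
  | succ i =>
    simp only [orderFil, ← mul_assoc]
    exact mul_le_mul_left mulOps_mul_firstOps _

theorem orderFil_mul (i j : ℕ) :
    orderFil k A i * orderFil k A j ≤ orderFil k A (i + j) := by
  induction i with
  | zero => simpa [orderFil] using mulOps_mul_orderFil j
  | succ i ih =>
    rw [Nat.succ_add]
    simp only [orderFil, mul_assoc]
    exact mul_le_mul_right ih _

theorem mul_mem_orderFil {i j : ℕ} {P Q : Module.End k A} (hP : P ∈ orderFil k A i)
    (hQ : Q ∈ orderFil k A j) : P * Q ∈ orderFil k A (i + j) :=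
  orderFil_mul i j (Submodule.mul_mem_mul hP hQ)

theorem mul_mem_orderFilLT {i j : ℕ} {P Q : Module.End k A} (hP : P ∈ orderFil k A i)
    (hQ : Q ∈ orderFilLT k A j) : P * Q ∈ orderFilLT k A (i + j) := by
  cases j with
  | zero =>
    obtain rfl : Q = 0 := hQ
    simp
  | succ j => exact mul_mem_orderFil hP hQ

theorem mul_mem_orderFilLT' {i j : ℕ} {P Q : Module.End k A} (hP : P ∈ orderFilLT k A i)
    (hQ : Q ∈ orderFil k A j) : P * Q ∈ orderFilLT k A (i + j) := by
  cases i with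
  | zero =>
    obtain rfl : P = 0 := hP
    simp
  | succ i =>
    rw [Nat.succ_add]
    exact mul_mem_orderFil hP hQ

theorem one_mem_firstOps : (1 : Module.End k A) ∈ firstOps k A :=
  mulOps_le_firstOps one_mem_mulOps

theorem orderFil_le_succ (i : ℕ) : orderFil k A i ≤ orderFil k A (i + 1) := fun P hP => by
  simpa [orderFil] using Submodule.mul_mem_mul (one_mem_firstOps (k := k) (A := A)) hP

theorem orderFil_mono : Monotone (orderFil k A) :=
  monotone_nat_of_le_succ orderFil_le_succ

theorem mem_orderFil_one {P : Module.End k A} (hP : P ∈ firstOps k A) : P ∈ orderFil k A 1 := by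
  simpa [orderFil] using Submodule.mul_mem_mul hP (one_mem_mulOps (k := k) (A := A))

/-- The order filtration exhausts the ring of differential operators. -/
theorem mem_diffOps_iff {P : Module.End k A} : P ∈ diffOps k A ↔ ∃ d, P ∈ orderFil k A d := by
  constructor
  · intro hP
    induction hP using Algebra.adjoin_induction with
    | mem x hx => exact ⟨1, mem_orderFil_one hx⟩
    | algebraMap r => exact ⟨0, algebraMap k A r, by ext x; simp [Algebra.smul_def]⟩
    | add x y _ _ hx hy =>
      obtain ⟨i, hi⟩ := hx
      obtain ⟨j, hj⟩ := hy
      exact ⟨max i j, add_mem (orderFil_mono (le_max_left i j) hi)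
        (orderFil_mono (le_max_right i j) hj)⟩
    | mul x y _ _ hx hy =>
      obtain ⟨i, hi⟩ := hx
      obtain ⟨j, hj⟩ := hy
      exact ⟨i + j, mul_mem_orderFil hi hj⟩
  · rintro ⟨d, hd⟩
    induction d generalizing P with
    | zero => exact Algebra.subset_adjoin (mulOps_le_firstOps hd)
    | succ d ih =>
      exact Submodule.mul_induction_on hd
        (fun R hR S hS => mul_mem (Algebra.subset_adjoin hR) (ih hS)) fun x y hx hy => add_mem hx hy

/-- A derivation that is not zero has order exactly one. -/
theorem derivation_mem_orderFilLT_one_iff (δ : Derivation k A A) :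
    (δ : A →ₗ[k] A) ∈ orderFilLT k A 1 ↔ δ = 0 := by
  constructor
  · rintro ⟨a, ha⟩
    have h : ∀ x, a * x = δ x := fun x => by simpa using LinearMap.congr_fun ha x
    have h1 : a = 0 := by simpa using h 1
    ext x
    simp [← h x, h1]
  · rintro rfl
    exact zero_mem _

theorem commutator_mulOps_firstOps {P Q : Module.End k A} (hP : P ∈ mulOps k A)
    (hQ : Q ∈ firstOps k A) : P * Q - Q * P ∈ mulOps k A := by
  obtain ⟨a, rfl⟩ := hP
  obtain ⟨b, δ, rfl⟩ := hQ
  refine ⟨-δ a, ?_⟩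
  ext x
  simp
  ring

theorem commutator_firstOps {P Q : Module.End k A} (hP : P ∈ firstOps k A)
    (hQ : Q ∈ firstOps k A) : P * Q - Q * P ∈ firstOps k A := by
  obtain ⟨a, δ, rfl⟩ := hP
  obtain ⟨b, ε, rfl⟩ := hQ
  refine ⟨δ b - ε a, ⁅δ, ε⁆, ?_⟩
  ext x
  simp [Derivation.commutator_coe_linear_map, Ring.lie_def]
  ring

theorem firstOps_mul_orderFilLT {j : ℕ} {P Q : Module.End k A} (hP : P ∈ firstOps k A)
    (hQ : Q ∈ orderFilLT k A j) : P * Q ∈ orderFil k A j := by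
  cases j with
  | zero =>
    obtain rfl : Q = 0 := hQ
    simp
  | succ j => exact Submodule.mul_mem_mul hP hQ

theorem commutator_firstOps_orderFil {j : ℕ} {P Q : Module.End k A} (hP : P ∈ firstOps k A)
    (hQ : Q ∈ orderFil k A j) : P * Q - Q * P ∈ orderFil k A j := by
  induction j generalizing Q with
  | zero =>
    rw [← neg_sub]
    exact neg_mem (commutator_mulOps_firstOps hQ hP)
  | succ j ih =>
    refine Submodule.mul_induction_on hQ (fun R hR S hS => ?_) fun x y hx hy => ?_
    · have e : P * (R * S) - R * S * P = (P * R - R * P) * S + R * (P * S - S * P) := by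
        simp only [mul_sub, sub_mul, mul_add, add_mul, mul_assoc]
        abel
      rw [e]
      exact add_mem (Submodule.mul_mem_mul (commutator_firstOps hP hR) hS)
        (Submodule.mul_mem_mul hR (ih hS))
    · have e : P * (x + y) - (x + y) * P = (P * x - x * P) + (P * y - y * P) := by
        simp only [mul_sub, sub_mul, mul_add, add_mul, mul_assoc]
        abel
      rw [e]
      exact add_mem hx hy

theorem commutator_mulOps_orderFil {j : ℕ} {P Q : Module.End k A} (hP : P ∈ mulOps k A)
    (hQ : Q ∈ orderFil k A j) : P * Q - Q * P ∈ orderFilLT k A j := by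
  induction j generalizing Q with
  | zero =>
    obtain ⟨a, rfl⟩ := hP
    obtain ⟨b, rfl⟩ := hQ
    refine (Submodule.mem_bot k).2 ?_
    ext x
    simp
    ring
  | succ j ih =>
    refine Submodule.mul_induction_on hQ (fun R hR S hS => ?_) fun x y hx hy => ?_
    · have e : P * (R * S) - R * S * P = (P * R - R * P) * S + R * (P * S - S * P) := by
        simp only [mul_sub, sub_mul, mul_add, add_mul, mul_assoc]
        abel
      rw [e]
      exact add_mem (mulOps_mul_orderFil j
        (Submodule.mul_mem_mul (commutator_mulOps_firstOps hP hR) hS))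
        (firstOps_mul_orderFilLT hR (ih hS))
    · have e : P * (x + y) - (x + y) * P = (P * x - x * P) + (P * y - y * P) := by
        simp only [mul_sub, sub_mul, mul_add, add_mul, mul_assoc]
        abel
      rw [e]
      exact add_mem hx hy

theorem commutator_mem {i j : ℕ} {P Q : Module.End k A} (hP : P ∈ orderFil k A i)
    (hQ : Q ∈ orderFil k A j) : P * Q - Q * P ∈ orderFilLT k A (i + j) := by
  induction i generalizing P with
  | zero =>
    rw [Nat.zero_add]
    exact commutator_mulOps_orderFil hP hQ
  | succ i ih =>
    rw [Nat.succ_add]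
    change _ ∈ orderFil k A (i + j)
    refine Submodule.mul_induction_on hP (fun R hR S hS => ?_) fun x y hx hy => ?_
    · have e : R * S * Q - Q * (R * S) = R * (S * Q - Q * S) + (R * Q - Q * R) * S := by
        simp only [mul_sub, sub_mul, mul_add, add_mul, mul_assoc]
        abel
      rw [e]
      refine add_mem (firstOps_mul_orderFilLT hR (ih hS)) ?_
      rw [add_comm i j]
      exact mul_mem_orderFil (commutator_firstOps_orderFil hR hQ) hS
    · have e : (x + y) * Q - Q * (x + y) = (x * Q - Q * x) + (y * Q - Q * y) := by
        simp only [mul_sub, sub_mul, mul_add, add_mul, mul_assoc]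
        abel
      rw [e]
      exact add_mem hx hy

variable (k A)

/-- The homogeneous part `Gr^d = F^d / F^(d-1)`. -/
abbrev GrPart (d : ℕ) : Type _ :=
  orderFil k A d ⧸ ((orderFilLT k A d).submoduleOf (orderFil k A d)).toAddSubgroup

variable {k A}

/-- The class in `Gr^d` of an operator of order `≤ d`. -/
def grMk (d : ℕ) (P : orderFil k A d) : GrPart k A d := QuotientAddGroup.mk P

theorem grMk_eq_iff {d : ℕ} {P Q : orderFil k A d} :
    grMk d P = grMk d Q ↔ (P : Module.End k A) - Q ∈ orderFilLT k A d := by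
  rw [← neg_mem_iff, neg_sub, sub_eq_neg_add]
  exact QuotientAddGroup.eq

theorem grMk_eq {d : ℕ} (P Q : orderFil k A d)
    (h : (P : Module.End k A) - Q ∈ orderFilLT k A d) : grMk d P = grMk d Q :=
  grMk_eq_iff.2 h

theorem grMk_surjective (d : ℕ) : Function.Surjective (grMk (k := k) (A := A) d) :=
  QuotientAddGroup.mk_surjective

/-- The product of `Gr`, induced by the composition of operators. -/
def grMul {i j : ℕ} (x : GrPart k A i) (y : GrPart k A j) : GrPart k A (i + j) :=
  Quotient.map₂ (fun (P : orderFil k A i) (Q : orderFil k A j) =>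
      (⟨P.1 * Q.1, mul_mem_orderFil P.2 Q.2⟩ : orderFil k A (i + j)))
    (by
      intro P P' hP Q Q' hQ
      rw [← Quotient.eq_iff_equiv] at hP hQ ⊢
      have h₁ := grMk_eq_iff.1 hP
      have h₂ := grMk_eq_iff.1 hQ
      refine grMk_eq_iff.2 ?_
      have e : (P : Module.End k A) * Q - P' * Q' = (P - P') * Q + P' * (Q - Q') := by
        simp only [mul_sub, sub_mul, mul_add, add_mul, mul_assoc]
        abel
      change (P : Module.End k A) * Q - P' * Q' ∈ _
      rw [e]
      exact add_mem (mul_mem_orderFilLT' h₁ Q.2) (mul_mem_orderFilLT P'.2 h₂)) x y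

theorem grMul_mk {i j : ℕ} (P : orderFil k A i) (Q : orderFil k A j) :
    grMul (grMk i P) (grMk j Q) = grMk (i + j) ⟨P.1 * Q.1, mul_mem_orderFil P.2 Q.2⟩ := rfl

theorem graded_ext {i j : ℕ} (h : i = j) {P : orderFil k A i} {Q : orderFil k A j}
    (hPQ : (P : Module.End k A) - Q ∈ orderFilLT k A i) :
    (GradedMonoid.mk i (grMk i P) : GradedMonoid (GrPart k A)) = GradedMonoid.mk j (grMk j Q) := by
  subst h
  rw [grMk_eq_iff.2 hPQ]

instance : GradedMonoid.GMul (GrPart k A) := ⟨grMul⟩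

instance : GradedMonoid.GOne (GrPart k A) := ⟨grMk 0 ⟨1, one_mem_mulOps⟩⟩

theorem intCast_mem (m : ℤ) : (m : Module.End k A) ∈ orderFil k A 0 :=
  ⟨m, by ext x; simp [Module.End.intCast_apply]⟩

theorem natCast_mem (m : ℕ) : (m : Module.End k A) ∈ orderFil k A 0 := by
  simpa using intCast_mem (k := k) (A := A) m

instance : DirectSum.GCommRing (GrPart k A) where
  one_mul := by
    rintro ⟨i, x⟩
    obtain ⟨P, rfl⟩ := grMk_surjective i x
    exact graded_ext (Nat.zero_add i) (by simp)
  mul_one := by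
    rintro ⟨i, x⟩
    obtain ⟨P, rfl⟩ := grMk_surjective i x
    exact graded_ext (Nat.add_zero i) (by simp)
  mul_assoc := by
    rintro ⟨i, x⟩ ⟨j, y⟩ ⟨l, z⟩
    obtain ⟨P, rfl⟩ := grMk_surjective i x
    obtain ⟨Q, rfl⟩ := grMk_surjective j y
    obtain ⟨R, rfl⟩ := grMk_surjective l z
    exact graded_ext (Nat.add_assoc i j l) (by simp [mul_assoc])
  mul_comm := by
    rintro ⟨i, x⟩ ⟨j, y⟩
    obtain ⟨P, rfl⟩ := grMk_surjective i x
    obtain ⟨Q, rfl⟩ := grMk_surjective j y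
    exact graded_ext (Nat.add_comm i j) (commutator_mem P.2 Q.2)
  mul_zero := by
    intro i j x
    obtain ⟨P, rfl⟩ := grMk_surjective i x
    exact grMk_eq _ (0) (by simp)
  zero_mul := by
    intro i j x
    obtain ⟨P, rfl⟩ := grMk_surjective j x
    exact grMk_eq _ (0) (by simp)
  mul_add := by
    intro i j x y z
    obtain ⟨P, rfl⟩ := grMk_surjective i x
    obtain ⟨Q, rfl⟩ := grMk_surjective j y
    obtain ⟨R, rfl⟩ := grMk_surjective j z
    exact grMk_eq ⟨P.1 * (Q + R).1, mul_mem_orderFil P.2 (Q + R).2⟩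
      (⟨P.1 * Q.1, mul_mem_orderFil P.2 Q.2⟩ + ⟨P.1 * R.1, mul_mem_orderFil P.2 R.2⟩)
      (by simp [mul_add])
  add_mul := by
    intro i j x y z
    obtain ⟨P, rfl⟩ := grMk_surjective i x
    obtain ⟨Q, rfl⟩ := grMk_surjective i y
    obtain ⟨R, rfl⟩ := grMk_surjective j z
    exact grMk_eq ⟨(P + Q).1 * R.1, mul_mem_orderFil (P + Q).2 R.2⟩
      (⟨P.1 * R.1, mul_mem_orderFil P.2 R.2⟩ + ⟨Q.1 * R.1, mul_mem_orderFil Q.2 R.2⟩)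
      (by simp [add_mul])
  natCast m := grMk 0 ⟨m, natCast_mem m⟩
  natCast_zero := grMk_eq (k := k) (A := A) (d := 0) ⟨(0 : ℕ), natCast_mem 0⟩ 0 (by simp)
  natCast_succ m := by
    let a : orderFil k A 0 := ⟨m, natCast_mem m⟩
    let b : orderFil k A 0 := ⟨1, one_mem_mulOps⟩
    exact grMk_eq ⟨(m + 1 : ℕ), natCast_mem (m + 1)⟩ (a + b) (by simp [a, b])
  intCast m := grMk 0 ⟨m, intCast_mem m⟩
  intCast_ofNat m := grMk_eq (k := k) (A := A) ⟨(m : ℤ), intCast_mem m⟩ ⟨m, natCast_mem m⟩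
    (by simp)
  intCast_negSucc_ofNat m := by
    let a : orderFil k A 0 := ⟨(m + 1 : ℕ), natCast_mem (m + 1)⟩
    exact grMk_eq ⟨(Int.negSucc m : ℤ), intCast_mem _⟩ (-a) (by simp [a])

variable (k A)

/-- The commutative graded ring `Gr = ⨁ F^d / F^(d-1)` of the ring of differential operators. -/
abbrev Gr : Type _ := DirectSum ℕ (GrPart k A)

variable {k A}

/-- The principal symbol of a derivation: its class in `F¹ / F⁰`. -/
def symbol (δ : Derivation k A A) : Gr k A :=
  DirectSum.of (GrPart k A) 1
    (grMk 1 ⟨(δ : A →ₗ[k] A), mem_orderFil_one (derivation_mem_firstOps δ)⟩)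

end DiffOps

/-! ### Hypersurfaces in complex manifolds -/

section Geometry

variable (n : ℕ) {X : Type*} [TopologicalSpace X] [ChartedSpace (Fin n → ℂ) X]

/-- The function `f` is holomorphic in a neighbourhood of `p`. -/
def HolomorphicNear (p : X) (f : X → ℂ) : Prop :=
  ContMDiffAt 𝓘(ℂ, Fin n → ℂ) 𝓘(ℂ) ω f p

/-- The ring `𝒪_{X,p}` of germs at `p` of holomorphic functions. -/
def holGerms (p : X) : Subring (Filter.Germ (𝓝 p) ℂ) where
  carrier := {g | ∃ f : X → ℂ, HolomorphicNear n p f ∧ (f : Filter.Germ (𝓝 p) ℂ) = g}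
  mul_mem' := by
    rintro _ _ ⟨f, hf, rfl⟩ ⟨g, hg, rfl⟩
    exact ⟨f * g, ContMDiffAt.mul hf hg, rfl⟩
  one_mem' := ⟨1, contMDiffAt_const, rfl⟩
  add_mem' := by
    rintro _ _ ⟨f, hf, rfl⟩ ⟨g, hg, rfl⟩
    exact ⟨f + g, ContMDiffAt.add hf hg, rfl⟩
  zero_mem' := ⟨0, contMDiffAt_const, rfl⟩
  neg_mem' := by
    rintro _ ⟨f, hf, rfl⟩
    exact ⟨-f, ContMDiffAt.neg hf, rfl⟩

/-- `𝒪_{X,p}` is a `ℂ`-algebra through the constant functions. -/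
instance (p : X) : Algebra ℂ (holGerms n p) :=
  RingHom.toAlgebra
    { toFun := fun c => ⟨((fun _ : X => c) : X → ℂ), fun _ => c, contMDiffAt_const, rfl⟩
      map_one' := rfl
      map_mul' := fun _ _ => rfl
      map_zero' := rfl
      map_add' := fun _ _ => rfl }

/-- `D` is a hypersurface of `X`: it is closed, and near each of its points it is the zero set of a
holomorphic function whose germ at that point is not zero. -/
structure IsHypersurface (D : Set X) : Prop where
  isClosed : IsClosed D
  exists_equation : ∀ p ∈ D, ∃ f : X → ℂ, HolomorphicNear n p f ∧ ¬ f =ᶠ[𝓝 p] 0 ∧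
    ∀ᶠ x in 𝓝 p, x ∈ D ↔ f x = 0

/-- The ideal of `𝒪_{X,p}` of the germs that vanish on `D` near `p`. -/
def vanishingIdeal (D : Set X) (p : X) : Ideal (holGerms n p) where
  carrier := {g | ∃ f : X → ℂ, (f : Filter.Germ (𝓝 p) ℂ) = g ∧ ∀ᶠ x in 𝓝 p, x ∈ D → f x = 0}
  add_mem' := by
    rintro ⟨_, _⟩ ⟨_, _⟩ ⟨f, rfl, hf⟩ ⟨g, rfl, hg⟩
    refine ⟨f + g, rfl, ?_⟩
    filter_upwards [hf, hg] with x h₁ h₂ hx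
    simp [h₁ hx, h₂ hx]
  zero_mem' := ⟨0, rfl, by simp⟩
  smul_mem' := by
    rintro ⟨_, c, _, rfl⟩ ⟨_, _⟩ ⟨f, rfl, hf⟩
    refine ⟨c * f, rfl, ?_⟩
    filter_upwards [hf] with x h₁ hx
    simp [h₁ hx]

/-- `h` is a reduced local equation of `D` at `p`: it generates the ideal of `D` at `p`. -/
def IsReducedEquation (D : Set X) (p : X) (h : holGerms n p) : Prop :=
  vanishingIdeal n D p = Ideal.span {h}

/-- `D` is of linear jacobian type at `p`: the jacobian ideal of a reduced local equation of `D`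
at `p`, which does not depend on the equation, is of linear type. -/
def IsOfLinearJacobianTypeAt (D : Set X) (p : X) : Prop :=
  ∃ h : holGerms n p, IsReducedEquation n D p h ∧ IsOfLinearType (jacobianIdeal ℂ h)

/-- `Der(log D)_p`: the derivations of `𝒪_{X,p}` that preserve the ideal of `D` at `p`. -/
abbrev logDerAt (D : Set X) (p : X) : Submodule (holGerms n p)
    (Derivation ℂ (holGerms n p) (holGerms n p)) :=
  logDer ℂ (vanishingIdeal n D p)

/-- `D` is free at `p`: the `𝒪_{X,p}`-module `Der(log D)_p` is free of rank `n = dim X`. -/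
def IsFreeAt (D : Set X) (p : X) : Prop :=
  Nonempty (Module.Basis (Fin n) (holGerms n p) (logDerAt n D p))

/-- `D` is Koszul free at `p`: it is free at `p` and the symbols of any basis of `Der(log D)_p` form
a regular sequence in the graded ring of the ring of differential operators of `𝒪_{X,p}`. -/
def IsKoszulFreeAt (D : Set X) (p : X) : Prop :=
  IsFreeAt n D p ∧ ∀ b : Module.Basis (Fin n) (holGerms n p) (logDerAt n D p),
    RingTheory.Sequence.IsRegular (Gr ℂ (holGerms n p)) (List.ofFn fun i => symbol (b i).1)

end Geometry

end

end LogGeom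

/-! Let A be the local ring, with coordinates x_i and dual derivations ∂_i. The graded ring of
differential operators is A[ξ₁, …, ξₙ], with ξᵢ the symbol of ∂ᵢ. A basis element δⱼ = ∑ aⱼᵢ ∂ᵢ of
the logarithmic derivations, with δⱼ(h) = αⱼ h, gives the symbol σⱼ = ∑ aⱼᵢ ξᵢ and also the linear
form lⱼ = σⱼ - αⱼ s in A[s, ξ]. A linear relation between h and the ∂ᵢ(h) is the same thing as a
logarithmic derivation. Hence, by linear type, the lⱼ generate all the equations of the Rees
algebra, i.e. the kernel of s ↦ h t, ξᵢ ↦ ∂ᵢ(h) t (`ker_reesPresentation_le_span`).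

The rest is a dimension count (`isWeaklyRegular_of_ker_reesPresentation_le`). This kernel is a prime
of height at least n in A[s, ξ]. A prime that contains s and the σⱼ contains the lⱼ, hence the
kernel, and strictly so because s ↦ h t ≠ 0; its height is therefore at least n + 1. At the
irrelevant ideal, whose height is at most 2n + 1, this leaves dimension at most n for A[ξ]/(σ₁, …,
σₙ). The localization of A[ξ] there has a regular sequence of length 2n, and in such a ring n
elements that cut the dimension down to n form a regular sequence
(`isWeaklyRegular_of_supportDim_le`). Since the σⱼ are homogeneous, regularity at the irrelevant
ideal gives regularity in A[ξ].

The graded ring is identified by `symbolHom`: it is surjective by induction on the order, and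
injective because the commutator with xᵢ acts as ∂/∂ξᵢ in characteristic zero.

That A is a noetherian local ring with the coordinates as a regular system of parameters comes from
its identification with the ring of convergent power series and from a division theorem
(`exists_division`). Each exponent α has a code, the product of the pᵢ ^ αᵢ for the first n primes
pᵢ. The codes order the monomials, and their inverse t-th powers are the weights of an ℓ¹-norm. For
large t the initial term of a series dominates the others, so division is inverted by a convergent
Neumann series. -/

namespace LogGeom

/-! ### Regular sequences and dimension over noetherian local rings -/

section CohenMacaulay

open IsLocalRing RingTheory.Sequence Module CategoryTheory Abelian Limits
open scoped Pointwise

universe u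

variable {R : Type*} [CommRing R] [IsNoetherianRing R] [IsLocalRing R]

/-- Dividing a module by a regular element enlarges its associated primes. -/
theorem exists_isAssociatedPrime_quotSMulTop_lt {M : Type*} [AddCommGroup M] [Module R M]
    [Module.Finite R M] {x : R} (hx : x ∈ maximalIdeal R) (hreg : IsSMulRegular M x)
    {P : Ideal R} (hP : IsAssociatedPrime P M) :
    ∃ Q, IsAssociatedPrime Q (QuotSMulTop x M) ∧ P < Q := by
  obtain ⟨hPp, y, hy⟩ := isAssociatedPrime_iff.1 hP
  have hy0 : y ≠ 0 := by
    rintro rfl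
    exact hPp.ne_top (by simp [hy])
  have hPy : ∀ p, p ∈ P ↔ p • y = 0 := fun p => by
    rw [hy, Submodule.mem_colon_singleton, Submodule.mem_bot]
  have hxP : x ∉ P := fun h => hy0 (hreg (by simpa using (hPy x).1 h))
  let N : Submodule R M := Submodule.torsionBySet R M P
  have hyN : y ∈ N := (Submodule.mem_torsionBySet_iff _ _).2 fun p => (hPy p).1 p.2
  -- Nakayama: if x m' is killed by P, so is m', because x is regular. Hence N ⊆ xM would give N =
  -- xN, so N = 0, although y lies in N.
  have hN : ¬ N ≤ x • (⊤ : Submodule R M) := by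
    intro hle
    have hle' : N ≤ Ideal.span {x} • N := by
      intro m hm
      obtain ⟨m', -, rfl⟩ := (Submodule.mem_smul_pointwise_iff_exists _ _ _).1 (hle hm)
      refine Submodule.smul_mem_smul (Ideal.mem_span_singleton_self x) ?_
      refine (Submodule.mem_torsionBySet_iff _ _).2 fun p => hreg ?_
      have h := (Submodule.mem_torsionBySet_iff _ _).1 hm p
      change x • (p : R) • m' = x • (0 : M)
      rw [smul_zero, smul_comm]
      exact h
    have : N = ⊥ := Submodule.eq_bot_of_le_smul_of_le_jacobson_bot (Ideal.span {x}) N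
      (IsNoetherian.noetherian N) hle' (by
        rw [Ideal.span_singleton_le_iff_mem]
        exact maximalIdeal_le_jacobson _ hx)
    exact hy0 (by simpa [this] using hyN)
  -- The class of m in M/xM is nonzero and is killed by P and by x, so an associated prime above its
  -- annihilator contains P and the element x outside P.
  obtain ⟨m, hmN, hm⟩ := Set.not_subset.1 hN
  have hm0 : (Submodule.Quotient.mk m : QuotSMulTop x M) ≠ 0 := by
    rwa [Ne, Submodule.Quotient.mk_eq_zero]
  obtain ⟨Q, hQ, hle⟩ := exists_le_isAssociatedPrime_of_isNoetherianRing R _ hm0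
  have hPQ : P ≤ Q := fun p hp => hle (by
    rw [Submodule.mem_colon_singleton, Submodule.mem_bot, ← Submodule.Quotient.mk_smul,
      (Submodule.mem_torsionBySet_iff _ _).1 hmN ⟨p, hp⟩, Submodule.Quotient.mk_zero])
  have hxQ : x ∈ Q := hle (by
    rw [Submodule.mem_colon_singleton, Submodule.mem_bot, ← Submodule.Quotient.mk_smul,
      Submodule.Quotient.mk_eq_zero]
    exact Submodule.smul_mem_pointwise_smul _ _ _ trivial)
  exact ⟨Q, hQ, lt_of_le_of_ne hPQ fun h => hxP (h ▸ hxQ)⟩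

/-- The dimension of an associated prime is at least the length of a regular sequence. -/
theorem length_le_coheight_of_isAssociatedPrime (rs : List R)
    (hrs : ∀ r ∈ rs, r ∈ maximalIdeal R) {M : Type*} [AddCommGroup M] [Module R M]
    [Module.Finite R M] (hreg : IsWeaklyRegular M rs) {P : Ideal R} (hP : IsAssociatedPrime P M) :
    (rs.length : ℕ∞) ≤ Order.coheight (⟨P, hP.isPrime⟩ : PrimeSpectrum R) := by
  induction rs generalizing M P with
  | nil => simp
  | cons x rs ih =>
    rw [isWeaklyRegular_cons_iff] at hreg
    simp only [List.mem_cons, forall_eq_or_imp] at hrs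
    obtain ⟨Q, hQ, hPQ⟩ := exists_isAssociatedPrime_quotSMulTop_lt hrs.1 hreg.1 hP
    refine le_trans ?_ (Order.coheight_add_one_le (a := ⟨Q, hQ.isPrime⟩) hPQ)
    simpa using add_le_add_left (ih hrs.2 hreg.2 hQ) 1

theorem length_le_supportDim_quotient (rs : List R)
    (hrs : ∀ r ∈ rs, r ∈ maximalIdeal R) {M : Type*} [AddCommGroup M] [Module R M]
    [Module.Finite R M] (hreg : IsWeaklyRegular M rs) {P : Ideal R} (hP : IsAssociatedPrime P M) :
    ((rs.length : ℕ∞) : WithBot ℕ∞) ≤ supportDim R (R ⧸ P) := by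
  have h := length_le_coheight_of_isAssociatedPrime rs hrs hreg hP
  have : supportDim R (R ⧸ P) = Order.coheight (⟨P, hP.isPrime⟩ : PrimeSpectrum R) := by
    rw [supportDim_quotient_eq_ringKrullDim, ringKrullDim_quotient, Order.coheight_eq_krullDim_Ici]
    rfl
  rw [this]
  exact_mod_cast h

/-- Each element of the maximal ideal lowers the dimension by at most one. -/
theorem supportDim_le_supportDim_quotient_add_length (rs : List R)
    (hrs : ∀ r ∈ rs, r ∈ maximalIdeal R) (M : Type*) [AddCommGroup M] [Module R M]
    [Module.Finite R M] :
    supportDim R M ≤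
      supportDim R (M ⧸ (Ideal.ofList rs • ⊤ : Submodule R M)) + ((rs.length : ℕ∞) : WithBot ℕ∞) := by
  induction rs generalizing M with
  | nil =>
    have e : M ≃ₗ[R] M ⧸ (Ideal.ofList ([] : List R) • ⊤ : Submodule R M) :=
      (Submodule.quotEquivOfEqBot _ (by simp)).symm
    simp [supportDim_eq_of_equiv e]
  | cons x rs ih =>
    simp only [List.mem_cons, forall_eq_or_imp] at hrs
    rw [supportDim_eq_of_equiv (Submodule.quotOfListConsSMulTopEquivQuotSMulTopInner M x rs)]
    refine (supportDim_le_supportDim_quotSMulTop_succ hrs.1).trans ?_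
    refine (add_le_add_left (ih hrs.2 (QuotSMulTop x M)) 1).trans ?_
    simp [add_assoc]

/-- Dividing by a regular element shortens regular sequences by at most one. -/
theorem exists_isRegular_quotSMulTop {R M : Type u} [CommRing R] [IsNoetherianRing R]
    [IsLocalRing R] [AddCommGroup M] [Module R M] [Module.Finite R M] [Nontrivial M] (d : ℕ)
    (hM : ∃ rs : List R, rs.length = d + 1 ∧ (∀ r ∈ rs, r ∈ maximalIdeal R) ∧ IsRegular M rs)
    {a : R} (ha : a ∈ maximalIdeal R) (hreg : IsSMulRegular M a) :
    ∃ rs : List R, rs.length = d ∧ (∀ r ∈ rs, r ∈ maximalIdeal R) ∧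
      IsRegular (QuotSMulTop a M) rs := by
  have hlt : ∀ (L : Type u) [AddCommGroup L] [Module R L] [Module.Finite R L] [Nontrivial L],
      maximalIdeal R • (⊤ : Submodule R L) < ⊤ := fun L _ _ _ _ =>
    (Submodule.top_ne_ideal_smul_of_le_jacobson_annihilator
      (maximalIdeal_le_jacobson _)).symm.lt_top
  obtain ⟨rs, hlen, hmem, hrs⟩ := hM
  -- Depth is read off from the vanishing of Extⁱ(N, -) for the residue field N. The long exact
  -- sequence of multiplication by a places Extⁱ(N, M/aM) between Extⁱ(N, M) and Extⁱ⁺¹(N, M), which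
  -- vanish for i < d.
  let N : ModuleCat.{u} R := ModuleCat.of R (R ⧸ maximalIdeal R)
  have hN : Module.support R N = PrimeSpectrum.zeroLocus (maximalIdeal R) := by
    rw [Module.support_eq_zeroLocus, Ideal.annihilator_quotient]
  have hext := ModuleCat.subsingleton_ext_of_exists_isRegular (maximalIdeal R) N hN.subset
    (ModuleCat.of R M) (hlt M) rs hmem hrs
  have := nontrivial_quotSMulTop_of_mem_maximalIdeal M ha
  refine ModuleCat.exists_isRegular_of_exists_subsingleton_ext (maximalIdeal R) d
    (ModuleCat.of R (QuotSMulTop a M)) (hlt _) N hN fun i hi => ?_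
  have zero1 := AddCommGrpCat.isZero_of_iff_subsingleton.mpr (hext i (by omega))
  have zero2 := AddCommGrpCat.isZero_of_iff_subsingleton.mpr (hext (i + 1) (by omega))
  exact AddCommGrpCat.subsingleton_of_isZero <| ShortComplex.Exact.isZero_of_both_zeros
    ((Ext.covariant_sequence_exact₃' N
      (IsSMulRegular.smulShortComplex_shortExact (M := ModuleCat.of R M) hreg)) i (i + 1) rfl)
    (zero1.eq_zero_of_src _) (zero2.eq_zero_of_tgt _)

/-- In a module of depth at least `d`, every sequence of length `r` that cuts the dimension down to
at most `d - r` is regular. -/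
theorem isWeaklyRegular_of_supportDim_le {R M : Type u} [CommRing R] [IsNoetherianRing R]
    [IsLocalRing R] [AddCommGroup M] [Module R M] [Module.Finite R M] [Nontrivial M] (d : ℕ)
    (hM : ∃ rs : List R, rs.length = d ∧ (∀ r ∈ rs, r ∈ maximalIdeal R) ∧ IsRegular M rs)
    (as : List R) (has : ∀ a ∈ as, a ∈ maximalIdeal R)
    (hdim : supportDim R (M ⧸ (Ideal.ofList as • ⊤ : Submodule R M)) +
      ((as.length : ℕ∞) : WithBot ℕ∞) ≤ ((d : ℕ∞) : WithBot ℕ∞)) :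
    IsWeaklyRegular M as := by
  induction as generalizing M d with
  | nil => exact .nil _ _
  | cons a as ih =>
    simp only [List.mem_cons, forall_eq_or_imp] at has
    -- A zero divisor a lies in an associated prime P, and dim R/P ≥ d by the depth hypothesis. As a
    -- acts by zero on R/P, the remaining elements alone would have to cut this dimension down to
    -- that of the final quotient, and they are one too few.
    have hreg : IsSMulRegular M a := by
      by_contra hna
      have hmem : a ∈ ⋃ p ∈ associatedPrimes R M, (p : Set R) := by
        rw [biUnion_associatedPrimes_eq_compl_regular]
        exact hna
      obtain ⟨P, hP, haP⟩ := Set.mem_iUnion₂.1 hmem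
      obtain ⟨rs, hlen, hmem, hrs⟩ := hM
      have h1 := length_le_supportDim_quotient rs hmem hrs.1 hP
      have h2 := supportDim_le_supportDim_quotient_add_length as has.2 (R ⧸ P)
      have h3 : supportDim R ((R ⧸ P) ⧸ (Ideal.ofList as • ⊤ : Submodule R (R ⧸ P))) ≤
          supportDim R (M ⧸ (Ideal.ofList (a :: as) • ⊤ : Submodule R M)) := by
        have hsupp : ∀ Q ∈ Module.support R
            ((R ⧸ P) ⧸ (Ideal.ofList as • ⊤ : Submodule R (R ⧸ P))),
            Q ∈ Module.support R (M ⧸ (Ideal.ofList (a :: as) • ⊤ : Submodule R M)) := by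
          intro Q hQ
          rw [Module.support_quotient, Module.support_eq_zeroLocus, Ideal.annihilator_quotient] at hQ
          rw [Module.support_quotient, Module.support_eq_zeroLocus]
          refine ⟨fun r hr => hQ.1 (hP.annihilator_le (by rwa [Submodule.annihilator_top])), ?_⟩
          rw [Ideal.ofList_cons, PrimeSpectrum.mem_zeroLocus, SetLike.coe_subset_coe, sup_le_iff,
            Ideal.span_singleton_le_iff_mem]
          exact ⟨hQ.1 haP, hQ.2⟩
        exact Order.krullDim_le_of_strictMono (fun Q => ⟨Q.1, hsupp Q.1 Q.2⟩) fun _ _ h => h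
      rw [hlen] at h1
      generalize supportDim R (M ⧸ (Ideal.ofList (a :: as) • ⊤ : Submodule R M)) = e at *
      have h4 := h1.trans (h2.trans (add_le_add_left h3 _))
      simp only [List.length_cons] at hdim
      induction e with
      | bot => simp at h4
      | coe e =>
        norm_cast at h4 hdim
        have he : e ≠ ⊤ := by
          rintro rfl
          simp at hdim
        lift e to ℕ using he
        norm_cast at h4 hdim
        omega
    have := nontrivial_quotSMulTop_of_mem_maximalIdeal M has.1
    rw [supportDim_eq_of_equiv (Submodule.quotOfListConsSMulTopEquivQuotSMulTopInner M a as)] at hdim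
    have : Nontrivial (QuotSMulTop a M ⧸
        (Ideal.ofList as • ⊤ : Submodule R (QuotSMulTop a M))) :=
      Submodule.Quotient.nontrivial_iff.2
        (Submodule.top_ne_ideal_smul_of_le_jacobson_annihilator
          ((Ideal.span_le.2 has.2).trans (maximalIdeal_le_jacobson _))).symm
    have hne := supportDim_ne_bot_of_nontrivial R (QuotSMulTop a M ⧸
        (Ideal.ofList as • ⊤ : Submodule R (QuotSMulTop a M)))
    -- The final quotient is nonzero by Nakayama, so its dimension is at least 0. This forces d ≥ 1
    -- and makes the subtraction harmless.
    have key : ∃ d', d = d' + 1 ∧ supportDim R (QuotSMulTop a M ⧸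
        (Ideal.ofList as • ⊤ : Submodule R (QuotSMulTop a M))) +
        ((as.length : ℕ∞) : WithBot ℕ∞) ≤ ((d' : ℕ∞) : WithBot ℕ∞) := by
      generalize supportDim R (QuotSMulTop a M ⧸
        (Ideal.ofList as • ⊤ : Submodule R (QuotSMulTop a M))) = e at *
      simp only [List.length_cons] at hdim
      induction e with
      | bot => exact absurd rfl hne
      | coe e =>
        norm_cast at hdim
        have he : e ≠ ⊤ := by
          rintro rfl
          simp at hdim
        lift e to ℕ using he
        norm_cast at hdim
        refine ⟨d - 1, by omega, ?_⟩
        norm_cast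
        omega
    obtain ⟨d', rfl, hd'⟩ := key
    exact (isWeaklyRegular_cons_iff _ _ _).2 ⟨hreg, ih d'
      (exists_isRegular_quotSMulTop d' hM has.1 hreg) has.2 hd'⟩

end CohenMacaulay

/-! ### Linear forms over a regular local ring -/

section LinearForms

open MvPolynomial RingTheory.Sequence IsLocalRing

variable {A : Type*} [CommRing A] {n : ℕ}

/-- The morphism `A[s, ξ₁, …, ξₙ] → A[s, ξ₁, …, ξₙ]` that sends `s` to `h s` and `ξᵢ` to `gᵢ s + ξᵢ`
for the first `r` indices `i`, to `gᵢ s` for the other ones. -/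
noncomputable def partialRees (h : A) (g : Fin n → A) (r : ℕ) :
    MvPolynomial (Option (Fin n)) A →ₐ[A] MvPolynomial (Option (Fin n)) A :=
  aeval fun o => o.elim (C h * X none) fun i =>
    C (g i) * X none + if (i : ℕ) < r then X (some i) else 0

/-- The morphism `A[s, ξ₁, …, ξₙ] → A[t]` that sends `s` to `h t` and `ξᵢ` to `gᵢ t`. Its image is
the Rees algebra of the ideal generated by `h` and the `gᵢ`. -/
noncomputable def reesPresentation (h : A) (g : Fin n → A) :
    MvPolynomial (Option (Fin n)) A →ₐ[A] Polynomial A :=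
  aeval fun o => o.elim (Polynomial.monomial 1 h) fun i => Polynomial.monomial 1 (g i)

/-- For r = 0 no ξᵢ survives in the images, and s ↦ t carries `partialRees` to the Rees
presentation. The maps with larger r serve to build a chain of primes below this kernel. -/
theorem ker_partialRees_zero_le (h : A) (g : Fin n → A) :
    RingHom.ker (partialRees h g 0) ≤ RingHom.ker (reesPresentation h g) := by
  have e : reesPresentation h g =
      (aeval fun o : Option (Fin n) => o.elim Polynomial.X fun _ => 0).comp
        (partialRees h g 0) := by
    refine MvPolynomial.algHom_ext fun o => ?_
    cases o <;> simp [reesPresentation, partialRees, Polynomial.C_mul_X_eq_monomial]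
  intro F hF
  rw [RingHom.mem_ker] at hF ⊢
  rw [e, AlgHom.comp_apply, hF, map_zero]

variable [IsDomain A]

instance (h : A) (g : Fin n → A) (r : ℕ) : (RingHom.ker (partialRees h g r)).IsPrime :=
  RingHom.ker_isPrime _

/-- Setting ξᵣ = 0 after the map of index r + 1 gives the map of index r. The form h ξᵣ - gᵣ s
separates the kernels: it is sent to 0 by the latter and to h ξᵣ by the former, up to a common
factor h. -/
theorem ker_partialRees_lt {h : A} (hh : h ≠ 0) (g : Fin n → A) {r : ℕ} (hr : r < n) :
    RingHom.ker (partialRees h g (r + 1)) < RingHom.ker (partialRees h g r) := by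
  have e : partialRees h g r =
      (aeval fun o : Option (Fin n) => o.elim (X none) fun i =>
        if (i : ℕ) < r then X (some i) else 0).comp (partialRees h g (r + 1)) := by
    refine MvPolynomial.algHom_ext fun o => ?_
    cases o with
    | none => simp [partialRees]
    | some i =>
      by_cases h1 : (i : ℕ) < r
      · simp [partialRees, h1, h1.le]
      · by_cases h2 : (i : ℕ) ≤ r <;> simp [partialRees, h1, h2]
  refine lt_of_le_of_ne (fun F hF => ?_) fun heq => ?_
  · rw [RingHom.mem_ker] at hF ⊢
    rw [e, AlgHom.comp_apply, hF, map_zero]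
  · let F : MvPolynomial (Option (Fin n)) A :=
      C h * X (some ⟨r, hr⟩) - C (g ⟨r, hr⟩) * X none
    have hF : F ∈ RingHom.ker (partialRees h g r) := by
      rw [RingHom.mem_ker]
      simp [F, partialRees, algHom_C]
      ring
    rw [← heq, RingHom.mem_ker] at hF
    have : partialRees h g (r + 1) F = C h * X (some ⟨r, hr⟩) := by
      simp [F, partialRees, algHom_C]
      ring
    rw [this] at hF
    simp [hh] at hF

theorem le_height_ker_partialRees {h : A} (hh : h ≠ 0) (g : Fin n → A) (r : ℕ) (hr : r ≤ n) :
    (r : ℕ∞) ≤ (RingHom.ker (partialRees h g (n - r))).height := by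
  induction r with
  | zero => simp
  | succ r ih =>
    have hlt := ker_partialRees_lt hh g (r := n - (r + 1)) (by omega)
    rw [show n - (r + 1) + 1 = n - r by omega] at hlt
    refine le_trans ?_ (Ideal.height_add_one_le_of_lt_of_isPrime hlt)
    push_cast
    exact add_le_add_left (ih (by omega)) 1

theorem X_none_notMem_ker_partialRees {h : A} (hh : h ≠ 0) (g : Fin n → A) (r : ℕ) :
    X none ∉ RingHom.ker (partialRees h g r) := by
  rw [RingHom.mem_ker]
  simp [partialRees, hh]

end LinearForms

/-! ### The irrelevant ideal of a polynomial ring over a local ring -/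

section Irrelevant

open MvPolynomial RingTheory.Sequence IsLocalRing

variable {A : Type*} [CommRing A] [IsLocalRing A] {n : ℕ}

/-- The ideal of the polynomials whose constant term is not a unit. -/
noncomputable def irrelevantIdeal (A : Type*) [CommRing A] [IsLocalRing A] (ι : Type*) :
    Ideal (MvPolynomial ι A) :=
  (maximalIdeal A).comap constantCoeff

instance (ι : Type*) : (irrelevantIdeal A ι).IsPrime :=
  Ideal.comap_isPrime _ _

theorem irrelevantIdeal_eq_span {ι : Type*} (x : Fin n → A)
    (hx : Ideal.span (Set.range x) = maximalIdeal A) :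
    irrelevantIdeal A ι =
      Ideal.span (Set.range (fun i => (C (x i) : MvPolynomial ι A)) ∪ Set.range X) := by
  apply le_antisymm
  · intro F hF
    have hF' : constantCoeff F ∈ maximalIdeal A := hF
    have h1 : C (constantCoeff F) ∈
        Ideal.span (Set.range (fun i => (C (x i) : MvPolynomial ι A))) := by
      have h := Ideal.mem_map_of_mem (C (σ := ι)) hF'
      rwa [← hx, Ideal.map_span, ← Set.range_comp] at h
    have h2 : F - C (constantCoeff F) ∈ Ideal.span (Set.range (X : ι → MvPolynomial ι A)) := by
      rw [← Set.image_univ, mem_ideal_span_X_image]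
      intro m hm
      by_contra! hm0
      have : m = 0 := by
        ext i
        exact hm0 i trivial
      subst this
      simp [constantCoeff_eq] at hm
    rw [← sub_add_cancel F (C (constantCoeff F))]
    exact add_mem (Ideal.span_mono Set.subset_union_right h2)
      (Ideal.span_mono Set.subset_union_left h1)
  · refine Ideal.span_le.2 (Set.union_subset ?_ ?_)
    · rintro _ ⟨i, rfl⟩
      change constantCoeff (C (x i)) ∈ maximalIdeal A
      rw [constantCoeff_C, ← hx]
      exact Ideal.subset_span ⟨i, rfl⟩
    · rintro _ ⟨i, rfl⟩
      change constantCoeff (X i) ∈ maximalIdeal A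
      simp

/-- Krull's height theorem, applied to the generators xᵢ of the maximal ideal together with the
variables. -/
theorem height_irrelevantIdeal_le [IsNoetherianRing A] {ι : Type*} [Fintype ι] (x : Fin n → A)
    (hx : Ideal.span (Set.range x) = maximalIdeal A) :
    (irrelevantIdeal A ι).height ≤ (n + Fintype.card ι : ℕ) := by
  classical
  let s : Set (MvPolynomial ι A) := Set.range (fun i => C (x i)) ∪ Set.range X
  have hs : s.Finite := (Set.finite_range _).union (Set.finite_range _)
  have hmin : irrelevantIdeal A ι ∈ (Ideal.span s).minimalPrimes := by
    rw [← irrelevantIdeal_eq_span x hx, Ideal.minimalPrimes_eq_subsingleton_self]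
    exact rfl
  refine (Ideal.height_le_card_of_mem_minimalPrimes_span hs hmin).trans ?_
  norm_cast
  refine (Set.ncard_union_le _ _).trans (add_le_add ?_ ?_)
  · rw [← Set.image_univ]
    exact (Set.ncard_image_le Set.finite_univ).trans (by simp [Set.ncard_univ])
  · rw [← Set.image_univ]
    exact (Set.ncard_image_le Set.finite_univ).trans (by simp [Set.ncard_univ])

/-- The variables, followed by a regular sequence of the coefficient ring, form a regular
sequence of the polynomial ring. -/
theorem isWeaklyRegular_X_append_C {A : Type*} [CommRing A] {xs : List A}
    (hx : IsWeaklyRegular A xs) :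
    IsWeaklyRegular (MvPolynomial (Fin n) A)
      (List.ofFn (X : Fin n → MvPolynomial (Fin n) A) ++ xs.map (algebraMap A _)) := by
  rw [isWeaklyRegular_append_iff]
  constructor
  · rw [isWeaklyRegular_iff_Fin]
    intro i
    rw [isSMulRegular_quotient_iff_mem_of_smul_mem]
    intro F hF
    -- An ideal generated by variables is tested on the monomials of the support, and multiplying by
    -- another variable does not change which of the generating variables occur.
    have hspan : (Ideal.ofList ((List.ofFn (X : Fin n → MvPolynomial (Fin n) A)).take i) • ⊤ :
        Submodule (MvPolynomial (Fin n) A) (MvPolynomial (Fin n) A)) =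
        Ideal.span (X '' {j : Fin n | (j : ℕ) < i}) := by
      rw [smul_eq_mul, Ideal.mul_top, Ideal.ofList]
      congr 1
      ext F
      simp only [Set.mem_ofPred_eq, Set.mem_image, List.mem_take_iff_getElem, List.length_ofFn,
        List.getElem_ofFn]
      constructor
      · rintro ⟨j, hj, rfl⟩
        exact ⟨⟨j, by omega⟩, by simpa using (lt_min_iff.1 hj).1, rfl⟩
      · rintro ⟨j, hj, rfl⟩
        exact ⟨j, lt_min hj j.2, rfl⟩
    rw [hspan, mem_ideal_span_X_image] at hF ⊢
    intro m hm
    have hi : (i : ℕ) < n := by simpa using i.2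
    have hm' : m + Finsupp.single ⟨i, hi⟩ 1 ∈
        ((List.ofFn (X : Fin n → MvPolynomial (Fin n) A))[i] • F).support := by
      rw [mem_support_iff] at hm ⊢
      have : (List.ofFn (X : Fin n → MvPolynomial (Fin n) A))[i] = X ⟨i, hi⟩ := by simp
      rwa [this, smul_eq_mul, mul_comm, coeff_mul_X]
    obtain ⟨j, hj, hmj⟩ := hF _ hm'
    refine ⟨j, hj, ?_⟩
    have hne : (⟨i, hi⟩ : Fin n) ≠ j := by
      rintro rfl
      simp at hj
    simpa [Finsupp.single_apply, hne] using hmj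
  · rw [isWeaklyRegular_map_algebraMap_iff]
    have hspan : (Ideal.ofList (List.ofFn (X : Fin n → MvPolynomial (Fin n) A)) • ⊤ :
        Submodule (MvPolynomial (Fin n) A) (MvPolynomial (Fin n) A)) =
        RingHom.ker (constantCoeff (R := A) (σ := Fin n)) := by
      rw [smul_eq_mul, Ideal.mul_top, Ideal.ofList]
      have : {r | r ∈ List.ofFn (X : Fin n → MvPolynomial (Fin n) A)} = X '' Set.univ := by
        ext; simp [List.mem_ofFn]
      rw [this]
      ext F
      rw [mem_ideal_span_X_image, RingHom.mem_ker, constantCoeff_eq]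
      constructor
      · intro h
        by_contra h0
        obtain ⟨i, -, hi⟩ := h 0 (mem_support_iff.2 h0)
        exact hi rfl
      · intro h m hm
        by_contra! hm0
        have : m = 0 := by
          ext i
          exact hm0 i trivial
        subst this
        exact mem_support_iff.1 hm h
    let f : MvPolynomial (Fin n) A →ₗ[A] A :=
      (aeval (0 : Fin n → A)).toLinearMap
    have hf : (Ideal.ofList (List.ofFn (X : Fin n → MvPolynomial (Fin n) A)) • ⊤ :
        Submodule (MvPolynomial (Fin n) A) (MvPolynomial (Fin n) A)).restrictScalars A =
        LinearMap.ker f := by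
      ext F
      rw [hspan]
      simp [f, RingHom.mem_ker, aeval_zero]
    let e₁ := f.quotKerEquivOfSurjective (fun a => ⟨C a, by simp [f]⟩)
    let e₂ := Submodule.Quotient.restrictScalarsEquiv A
      (Ideal.ofList (List.ofFn (X : Fin n → MvPolynomial (Fin n) A)) • ⊤ :
        Submodule (MvPolynomial (Fin n) A) (MvPolynomial (Fin n) A))
    let e := (e₂.symm.trans (Submodule.quotEquivOfEq _ _ hf)).trans e₁
    exact (e.isWeaklyRegular_congr xs).2 hx

/-- A sequence of linear forms is regular if it is so locally at the irrelevant ideal. -/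
theorem isWeaklyRegular_of_isWeaklyRegular_localization {ι : Type*}
    (as : List (MvPolynomial ι A)) (has : ∀ a ∈ as, a.IsHomogeneous 1)
    (h : IsWeaklyRegular (Localization.AtPrime (irrelevantIdeal A ι))
      (as.map (algebraMap _ (Localization.AtPrime (irrelevantIdeal A ι))))) :
    IsWeaklyRegular (MvPolynomial ι A) as := by
  classical
  rw [isWeaklyRegular_iff] at h ⊢
  intro i hi
  have h := h i (by simpa using hi)
  rw [isSMulRegular_quotient_iff_mem_of_smul_mem] at h ⊢
  intro F hF
  rw [smul_eq_mul, Ideal.mul_top] at hF ⊢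
  simp only [smul_eq_mul, Ideal.mul_top, ← List.map_take, ← Ideal.map_ofList] at h
  set I := Ideal.ofList (as.take i) with hI
  let : GradedAlgebra (homogeneousSubmodule ι A) := MvPolynomial.gradedAlgebra
  have hdec : ∀ (G : MvPolynomial ι A) (d : ℕ),
      (DirectSum.decompose (homogeneousSubmodule ι A) G d : MvPolynomial ι A) =
        homogeneousComponent d G := fun G d => decomposition.decompose'_apply G d
  have hIh : I.IsHomogeneous (homogeneousSubmodule ι A) :=
    Ideal.homogeneous_span _ _ fun a ha => ⟨1, has a (List.mem_of_mem_take ha)⟩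
  have hcomp : ∀ G ∈ I, ∀ d, homogeneousComponent d G ∈ I := fun G hG d =>
    hdec G d ▸ hIh d hG
  have hcomp_mul : ∀ {e : ℕ} {a G : MvPolynomial ι A} (d : ℕ), a.IsHomogeneous e →
      homogeneousComponent (e + d) (a * G) = a * homogeneousComponent d G := by
    intro e a G d ha
    rw [← hdec, ← hdec]
    exact DirectSum.coe_decompose_mul_add_of_left_mem (homogeneousSubmodule ι A) (i := e) (j := d)
      (b := G) ha
  have key : ∀ d, homogeneousComponent d F ∈ I := by
    intro d
    have h1 : as[i] * homogeneousComponent d F ∈ I := by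
      rw [← hcomp_mul d (has _ (List.getElem_mem hi))]
      exact hcomp _ hF _
    have h2 := h (algebraMap _ _ (homogeneousComponent d F)) (by
      rw [List.getElem_map, ← map_mul]
      exact Ideal.mem_map_of_mem _ h1)
    -- The multiplier u has a unit constant term u₀. The component of degree d of u · F_d is u₀ F_d,
    -- and it lies in I since I is homogeneous.
    obtain ⟨u, hu, hud⟩ := (IsLocalization.algebraMap_mem_map_algebraMap_iff
      (irrelevantIdeal A ι).primeCompl _ _ _).1 h2
    have h3 := hcomp _ hud d
    rw [mul_comm] at h3
    have h4 := hcomp_mul (G := u) 0 (homogeneousComponent_isHomogeneous d F)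
    rw [add_zero] at h4
    rw [h4, homogeneousComponent_zero] at h3
    have hunit : IsUnit (coeff 0 u) := by
      by_contra hnu
      exact hu ((mem_maximalIdeal _).2 hnu)
    exact (Ideal.mul_unit_mem_iff_mem _ (hunit.map C)).1 h3
  rw [← sum_homogeneousComponent F]
  exact sum_mem fun d _ => key d

end Irrelevant

/-! ### The dimension count for the equations of the Rees algebra -/

section RegularLinearForms

open MvPolynomial RingTheory.Sequence IsLocalRing Module

/-- Heights grow by at least one at each step, so the heights of its ends bound the length of a
chain. -/
theorem height_head_add_length_le {α : Type*} [Preorder α] (p : LTSeries α) :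
    Order.height p.head + p.length ≤ Order.height p.last := by
  have h : ∀ i : ℕ, ∀ hi : i < p.length + 1,
      Order.height p.head + (i : ℕ∞) ≤ Order.height (p ⟨i, hi⟩) := by
    intro i
    induction i with
    | zero => intro hi; simp [RelSeries.head]
    | succ i ih =>
      intro hi
      have hlt : p ⟨i, by omega⟩ < p ⟨i + 1, hi⟩ := p.strictMono (by simp)
      refine le_trans ?_ (Order.height_add_one_le hlt)
      push_cast
      rw [← add_assoc]
      exact add_le_add_left (ih (by omega)) 1
  exact h p.length (Nat.lt_succ_self _)

/-- Let `A` be a regular local ring of dimension `n`. If `n` linear forms `ℓⱼ` of `A[s, ξ₁, …, ξₙ]`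
generate the equations of the Rees algebra of `(h, g₁, …, gₙ)` with `h ≠ 0`, then their values at
`s = 0` form a regular sequence. -/
theorem isWeaklyRegular_of_ker_reesPresentation_le {A : Type*} [CommRing A] [IsNoetherianRing A]
    [IsLocalRing A] [IsDomain A] {n : ℕ} (x : Fin n → A)
    (hx : Ideal.span (Set.range x) = maximalIdeal A) (hxr : IsWeaklyRegular A (List.ofFn x))
    {h : A} (hh : h ≠ 0) (g : Fin n → A) (l : Fin n → MvPolynomial (Option (Fin n)) A)
    (hl : RingHom.ker (reesPresentation h g) ≤ Ideal.span (Set.range l))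
    (σ : Fin n → MvPolynomial (Fin n) A) (hσ : ∀ j, (σ j).IsHomogeneous 1)
    (hlσ : ∀ j, aeval (fun o : Option (Fin n) => o.elim 0 X) (l j) = σ j) :
    IsWeaklyRegular (MvPolynomial (Fin n) A) (List.ofFn σ) := by
  let M := irrelevantIdeal A (Fin n)
  let R := Localization.AtPrime M
  apply isWeaklyRegular_of_isWeaklyRegular_localization
  · intro a ha
    obtain ⟨j, rfl⟩ := List.mem_ofFn.1 ha
    exact hσ j
  have hσM : ∀ j, σ j ∈ M := fun j => by
    change constantCoeff (σ j) ∈ maximalIdeal A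
    rw [constantCoeff_eq, (hσ j).coeff_eq_zero (by simp)]
    exact zero_mem _
  have hmem : ∀ a ∈ (List.ofFn σ).map (algebraMap (MvPolynomial (Fin n) A) R),
      a ∈ maximalIdeal R := by
    intro a ha
    obtain ⟨b, hb, rfl⟩ := List.mem_map.1 ha
    obtain ⟨j, rfl⟩ := List.mem_ofFn.1 hb
    exact (IsLocalization.AtPrime.to_map_mem_maximal_iff R M _).2 (hσM j)
  have hdepth := (isWeaklyRegular_X_append_C (n := n) hxr).isRegular_of_isLocalization_of_mem R M
    (by
      intro a ha
      change constantCoeff a ∈ maximalIdeal A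
      rcases List.mem_append.1 ha with ha | ha
      · obtain ⟨j, rfl⟩ := List.mem_ofFn.1 ha
        simp
      · obtain ⟨b, hb, rfl⟩ := List.mem_map.1 ha
        obtain ⟨j, rfl⟩ := List.mem_ofFn.1 hb
        rw [algebraMap_eq, constantCoeff_C, ← hx]
        exact Ideal.subset_span ⟨j, rfl⟩)
  refine isWeaklyRegular_of_supportDim_le (2 * n)
    ⟨_, by simp; omega, ?_, hdepth⟩ _ hmem ?_
  · intro a ha
    by_contra hna
    apply hdepth.top_ne_smul
    rw [smul_eq_mul, Ideal.mul_top, eq_comm]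
    refine Ideal.eq_top_of_isUnit_mem _ (Ideal.subset_span ha) ?_
    simpa using hna
  let e : MvPolynomial (Option (Fin n)) A →ₐ[A] MvPolynomial (Fin n) A :=
    aeval fun o : Option (Fin n) => o.elim 0 X
  have he : Function.Surjective e := fun F =>
    ⟨rename some F, by
      simp only [e, aeval_rename]
      exact aeval_X_left_apply F⟩
  -- The inclusion of the local spectrum in the hyperplane s = 0: chains of primes of R are measured
  -- by heights in A[s, ξ], where the Rees equations live.
  let c : PrimeSpectrum R → PrimeSpectrum (MvPolynomial (Option (Fin n)) A) := fun Q =>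
    PrimeSpectrum.comap (e : MvPolynomial (Option (Fin n)) A →+* MvPolynomial (Fin n) A)
      (PrimeSpectrum.comap (algebraMap (MvPolynomial (Fin n) A) R) Q)
  have hc : StrictMono c := by
    refine Monotone.strictMono_of_injective ?_ ?_
    · exact fun Q Q' hQ a ha => hQ ha
    · exact (PrimeSpectrum.comap_injective_of_surjective _ he).comp
        (PrimeSpectrum.localization_comap_injective R M.primeCompl)
  have hsupp : supportDim R (R ⧸ (Ideal.ofList ((List.ofFn σ).map
      (algebraMap (MvPolynomial (Fin n) A) R)) • ⊤ : Submodule R R)) ≤ ((n : ℕ∞) : WithBot ℕ∞) := by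
    refine iSup_le fun p => ?_
    let q : LTSeries (PrimeSpectrum (MvPolynomial (Option (Fin n)) A)) :=
      p.map (fun Q => c Q.1) fun Q Q' hQ => hc hQ
    have hq := height_head_add_length_le q
    -- The irrelevant ideal of A[s, ξ] has n + (n + 1) generators.
    have hlast : Order.height q.last ≤ (2 * n + 1 : ℕ) := by
      rw [← PrimeSpectrum.height_eq_orderHeight]
      refine (Ideal.height_mono (J := irrelevantIdeal A (Option (Fin n))) ?_).trans
        ((height_irrelevantIdeal_le x hx).trans (by simp; norm_cast; omega))
      intro F hF
      have hF' : algebraMap _ R (e F) ∈ p.last.1.asIdeal := by simpa [q, c] using hF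
      have hM := (IsLocalization.AtPrime.to_map_mem_maximal_iff R M _).1
        (le_maximalIdeal p.last.1.isPrime.ne_top hF')
      change constantCoeff F ∈ maximalIdeal A
      have : constantCoeff (e F) = constantCoeff F := by
        have : (constantCoeff (R := A) (σ := Fin n)).comp
            (e : MvPolynomial (Option (Fin n)) A →+* MvPolynomial (Fin n) A) = constantCoeff := by
          refine MvPolynomial.ringHom_ext (fun a => by simp [e, algHom_C]) fun o => ?_
          cases o <;> simp [e]
        exact RingHom.congr_fun this F
      rw [← this]
      exact hM
    -- The pulled-back prime contains each lⱼ, whose value at s = 0 is σⱼ, hence the Rees equations.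
    -- It also contains s, which is not one of them; this gives the extra unit of height.
    have hhead : ((n + 1 : ℕ) : ℕ∞) ≤ Order.height q.head := by
      rw [← PrimeSpectrum.height_eq_orderHeight]
      have h0 := le_height_ker_partialRees hh g n le_rfl
      rw [Nat.sub_self] at h0
      have hQ := (Module.support_quotient _).subset p.head.2
      have hQσ : ∀ j, algebraMap _ R (σ j) ∈ p.head.1.asIdeal := fun j =>
        hQ.2 (Ideal.subset_span (List.mem_map.2 ⟨σ j, List.mem_ofFn.2 ⟨j, rfl⟩, rfl⟩))
      have hmemq : ∀ F, F ∈ q.head.asIdeal ↔ algebraMap _ R (e F) ∈ p.head.1.asIdeal := by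
        intro F
        simp [q, c]
      have hle : RingHom.ker (partialRees h g 0) ≤ q.head.asIdeal := by
        refine (ker_partialRees_zero_le h g).trans (hl.trans (Ideal.span_le.2 ?_))
        rintro _ ⟨j, rfl⟩
        refine (hmemq _).2 ?_
        rw [show e (l j) = σ j from hlσ j]
        exact hQσ j
      have hlt : RingHom.ker (partialRees h g 0) < q.head.asIdeal := by
        refine lt_of_le_of_ne hle fun heq => X_none_notMem_ker_partialRees hh g 0 ?_
        rw [heq]
        refine (hmemq _).2 ?_
        simp [e]
      refine le_trans ?_ (Ideal.height_add_one_le_of_lt_of_isPrime hlt)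
      push_cast
      exact add_le_add_left h0 1
    have hlen : q.length = p.length := rfl
    rw [hlen] at hq
    have h1 := ((add_le_add_left hhead _).trans hq).trans hlast
    norm_cast at h1 ⊢
    omega
  have h2 := add_le_add_left hsupp (((((List.ofFn σ).map
      (algebraMap (MvPolynomial (Fin n) A) R)).length : ℕ∞)) : WithBot ℕ∞)
  refine h2.trans ?_
  simp only [List.length_map, List.length_ofFn]
  norm_cast
  omega

end RegularLinearForms

/-! ### Equations of the Rees algebra from logarithmic derivations -/

section LinearTypePresentation

open MvPolynomial

/-- The equations of the Rees algebra of an ideal of linear type are generated by the linear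
ones. -/
theorem IsOfLinearType.ker_aeval_toRees_le {A : Type*} [CommRing A] {I : Ideal A}
    (hI : IsOfLinearType I) {ι : Type*} (y : ι → I) (hy : Submodule.span A (Set.range y) = ⊤)
    (K : Ideal (MvPolynomial ι A))
    (hK : ∀ c : ι →₀ A, Finsupp.linearCombination A y c = 0 →
      Finsupp.linearCombination A (X : ι → MvPolynomial ι A) c ∈ K) :
    RingHom.ker (aeval fun i => toRees I (y i) : MvPolynomial ι A →ₐ[A] reesAlgebra I) ≤ K := by
  let f := Finsupp.linearCombination A y
  have hf : Function.Surjective f := by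
    rw [← LinearMap.range_eq_top, Finsupp.range_linearCombination, hy]
  let q : MvPolynomial ι A →ₐ[A] MvPolynomial ι A ⧸ K := Ideal.Quotient.mkₐ A K
  let g : (ι →₀ A) →ₗ[A] MvPolynomial ι A ⧸ K :=
    q.toLinearMap ∘ₗ Finsupp.linearCombination A (X : ι → MvPolynomial ι A)
  have hfg : LinearMap.ker f ≤ LinearMap.ker g := fun c hc => by
    rw [LinearMap.mem_ker] at hc ⊢
    exact Ideal.Quotient.eq_zero_iff_mem.2 (hK c hc)
  -- The map ∑ cᵢ yᵢ ↦ ∑ cᵢ Xᵢ is well defined modulo K because K contains the linear relations. It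
  -- extends to Sym(I), so the projection onto the quotient by K factors through Sym(I). A
  -- polynomial that vanishes in the Rees algebra vanishes in Sym(I) by linear type, hence lies in
  -- K.
  let φ : I →ₗ[A] MvPolynomial ι A ⧸ K :=
    (LinearMap.ker f).liftQ g hfg ∘ₗ (f.quotKerEquivOfSurjective hf).symm.toLinearMap
  have hφ : ∀ i, φ (y i) = q (X i) := fun i => by
    have h1 : f.quotKerEquivOfSurjective hf (Submodule.Quotient.mk (Finsupp.single i 1)) = y i := by
      rw [LinearMap.quotKerEquivOfSurjective_apply_mk]
      simp [f]
    have h2 : (f.quotKerEquivOfSurjective hf).symm (y i) =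
        Submodule.Quotient.mk (Finsupp.single i 1) := by
      rw [LinearEquiv.symm_apply_eq, h1]
    change (LinearMap.ker f).liftQ g hfg ((f.quotKerEquivOfSurjective hf).symm (y i)) = _
    rw [h2]
    change g (Finsupp.single i 1) = _
    simp [g]
  let u : MvPolynomial ι A →ₐ[A] SymmetricAlgebra A I :=
    aeval fun i => SymmetricAlgebra.ι A I (y i)
  have hu : (SymmetricAlgebra.lift (toRees I)).comp u = aeval fun i => toRees I (y i) := by
    refine MvPolynomial.algHom_ext fun i => ?_
    simp [u]
  have hq : (SymmetricAlgebra.lift φ).comp u = q := by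
    refine MvPolynomial.algHom_ext fun i => ?_
    simp [u, hφ]
  intro F hF
  rw [RingHom.mem_ker, ← hu, AlgHom.comp_apply] at hF
  have hu0 : u F = 0 := hI.1 (by rw [hF, map_zero])
  have hqF : q F = 0 := by rw [← hq, AlgHom.comp_apply, hu0, map_zero]
  exact Ideal.Quotient.eq_zero_iff_mem.1 hqF

theorem derivation_sum_apply {k A ι : Type*} [CommRing k] [CommRing A] [Algebra k A]
    (s : Finset ι) (δ : ι → Derivation k A A) (a : A) : (∑ i ∈ s, δ i) a = ∑ i ∈ s, δ i a :=
  map_sum ({ toFun := fun δ => δ a, map_zero' := rfl, map_add' := fun _ _ => rfl } :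
    Derivation k A A →+ A) δ s

/-- The equations of the Rees algebra of the jacobian ideal of a free divisor of linear jacobian
type come from the logarithmic derivations. -/
theorem ker_reesPresentation_le_span {k A : Type*} [CommRing k] [CommRing A] [IsDomain A]
    [Algebra k A] {n : ℕ} (d : Module.Basis (Fin n) A (Derivation k A A)) {h : A} (hh : h ≠ 0)
    (hlin : IsOfLinearType (jacobianIdeal k h))
    (b : Module.Basis (Fin n) A (logDer k (Ideal.span {h}))) (α : Fin n → A)
    (hα : ∀ j, (b j).1 h = α j * h) :
    RingHom.ker (reesPresentation h fun i => d i h) ≤ Ideal.span (Set.range fun j =>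
      ∑ i, C (d.repr (b j).1 i) * X (some i) - C (α j) * (X none : MvPolynomial (Option (Fin n)) A))
    := by
  have hJ : jacobianIdeal k h = Ideal.span ({h} ∪ Set.range fun i => d i h) :=
    jacobianIdeal_eq k _ d.span_eq h
  have hmem : ∀ o : Option (Fin n), o.elim h (fun i => d i h) ∈ jacobianIdeal k h := by
    rintro (_ | i)
    · exact Ideal.subset_span (Or.inl rfl)
    · exact Ideal.subset_span (Or.inr ⟨d i, rfl⟩)
  let y : Option (Fin n) → jacobianIdeal k h := fun o => ⟨_, hmem o⟩
  have hy : Submodule.span A (Set.range y) = ⊤ := by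
    refine Submodule.map_injective_of_injective (jacobianIdeal k h).subtype_injective ?_
    rw [Submodule.map_span, ← Set.range_comp, Submodule.map_subtype_top]
    refine Eq.trans ?_ hJ.symm
    change Submodule.span A _ = Submodule.span A _
    congr 1
    ext a
    constructor
    · rintro ⟨_ | i, rfl⟩
      · exact Or.inl rfl
      · exact Or.inr ⟨i, rfl⟩
    · rintro (rfl | ⟨i, rfl⟩)
      · exact ⟨none, rfl⟩
      · exact ⟨some i, rfl⟩
  have key := hlin.ker_aeval_toRees_le y hy (Ideal.span (Set.range fun j =>
      ∑ i, C (d.repr (b j).1 i) * X (some i) -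
        C (α j) * (X none : MvPolynomial (Option (Fin n)) A))) ?_
  · intro F hF
    apply key
    rw [RingHom.mem_ker] at hF ⊢
    have e : ((reesAlgebra (jacobianIdeal k h)).val).comp
        (aeval fun o => toRees (jacobianIdeal k h) (y o)) = reesPresentation h fun i => d i h := by
      refine MvPolynomial.algHom_ext fun o => ?_
      cases o <;> simp [reesPresentation, toRees, y]
    apply Subtype.val_injective
    rw [← e] at hF
    exact hF
  · intro c hc
    have hc' : c none * h + ∑ i, c (some i) * d i h = 0 := by
      have := congrArg Subtype.val hc
      rw [Finsupp.linearCombination_apply, Finsupp.sum_fintype _ _ (by simp)] at this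
      simpa [Fintype.sum_option, y] using this
    -- The relation says δ(h) = -c₀ h, so δ is logarithmic and can be expanded in the basis b.
    let δ : Derivation k A A := ∑ i, c (some i) • d i
    have hδh : δ h = -c none * h := by
      simp only [δ, derivation_sum_apply, Derivation.smul_apply, smul_eq_mul]
      linear_combination hc'
    have hδ : δ ∈ logDer k (Ideal.span {h}) := by
      intro a ha
      obtain ⟨r, rfl⟩ := Ideal.mem_span_singleton'.1 ha
      rw [Derivation.leibniz, hδh]
      refine Ideal.mem_span_singleton'.2 ⟨-r * c none + δ r, ?_⟩
      simp only [smul_eq_mul]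
      ring
    let a := b.repr ⟨δ, hδ⟩
    have hδa : δ = ∑ j, a j • (b j).1 := by
      have h1 := congrArg (logDer k (Ideal.span {h})).subtype (b.sum_repr ⟨δ, hδ⟩)
      rw [map_sum] at h1
      exact h1.symm
    -- The coefficient of s is determined by the others, as h can be cancelled.
    have hnone : c none = -∑ j, a j * α j := by
      apply mul_right_cancel₀ hh
      have : δ h = ∑ j, a j * (α j * h) := by
        rw [hδa, derivation_sum_apply]
        simp only [Derivation.smul_apply, smul_eq_mul, hα]
      rw [hδh] at this
      rw [neg_mul, Finset.sum_mul]
      simp only [mul_assoc]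
      linear_combination -this
    have hsome : ∀ i, c (some i) = ∑ j, a j * d.repr (b j).1 i := by
      intro i
      have h1 : d.repr δ i = c (some i) := by
        simp [δ, Finsupp.single_apply]
      rw [← h1, hδa]
      simp
    rw [Finsupp.linearCombination_apply, Finsupp.sum_fintype _ _ (by simp), Fintype.sum_option]
    have : c none • (X none : MvPolynomial (Option (Fin n)) A) + ∑ i, c (some i) • X (some i) =
        ∑ j, C (a j) * (∑ i, C (d.repr (b j).1 i) * X (some i) - C (α j) * X none) := by
      simp only [smul_eq_C_mul, hnone, hsome, map_neg, map_sum, mul_sub, Finset.sum_sub_distrib,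
        Finset.mul_sum, Finset.sum_mul, map_mul, neg_mul]
      rw [Finset.sum_comm, add_comm, ← sub_eq_add_neg]
      simp only [mul_assoc]
    rw [this]
    exact sum_mem fun j _ => Ideal.mul_mem_left _ _ (Ideal.subset_span ⟨j, rfl⟩)

end LinearTypePresentation

/-! ### The graded ring of differential operators is a polynomial ring -/

section GradedRing

open MvPolynomial DirectSum

variable {k A : Type*} [CommRing k] [CommRing A] [Algebra k A]

/-- The functions, as elements of degree zero of the graded ring. -/
noncomputable def grC : A →+* Gr k A where
  toFun a := DirectSum.of (GrPart k A) 0 (grMk 0 ⟨LinearMap.mul k A a, a, rfl⟩)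
  map_one' := congrArg (DirectSum.of (GrPart k A) 0) (grMk_eq _ _ (by
    refine (Submodule.mem_bot k).2 ?_
    ext x
    simp))
  map_mul' a b := by
    rw [DirectSum.of_mul_of]
    refine congrArg (DirectSum.of (GrPart k A) 0) (grMk_eq _ _ ?_)
    refine (Submodule.mem_bot k).2 ?_
    ext x
    simp [mul_assoc]
  map_zero' := by
    rw [← map_zero (DirectSum.of (GrPart k A) 0)]
    refine congrArg (DirectSum.of (GrPart k A) 0) (grMk_eq _ 0 ?_)
    refine (Submodule.mem_bot k).2 ?_
    ext x
    simp
  map_add' a b := by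
    rw [← map_add (DirectSum.of (GrPart k A) 0)]
    refine congrArg (DirectSum.of (GrPart k A) 0) (grMk_eq _
      ((⟨LinearMap.mul k A a, a, rfl⟩ : orderFil k A 0) + ⟨LinearMap.mul k A b, b, rfl⟩) ?_)
    refine (Submodule.mem_bot k).2 ?_
    ext x
    simp

theorem symbol_add (δ ε : Derivation k A A) : symbol (δ + ε) = symbol δ + symbol ε := by
  rw [symbol, symbol, symbol, ← map_add (DirectSum.of (GrPart k A) 1)]
  exact congrArg (DirectSum.of (GrPart k A) 1) (grMk_eq _
    (⟨(δ : A →ₗ[k] A), mem_orderFil_one (derivation_mem_firstOps δ)⟩ +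
      ⟨(ε : A →ₗ[k] A), mem_orderFil_one (derivation_mem_firstOps ε)⟩) (by simp))

theorem symbol_smul (a : A) (δ : Derivation k A A) : symbol (a • δ) = grC a * symbol δ := by
  change _ = DirectSum.of (GrPart k A) 0 _ * DirectSum.of (GrPart k A) 1 _
  rw [DirectSum.of_mul_of]
  refine congrArg (DirectSum.of (GrPart k A) 1) (grMk_eq _ _ ?_)
  rw [show (((a • δ : Derivation k A A) : A →ₗ[k] A) : Module.End k A) -
      LinearMap.mul k A a * (δ : A →ₗ[k] A) = 0 by ext x; simp]
  exact zero_mem _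

theorem symbol_zero : symbol (0 : Derivation k A A) = 0 := by
  have := symbol_smul (0 : A) (0 : Derivation k A A)
  rwa [zero_smul, map_zero, zero_mul] at this

theorem symbol_sum {ι : Type*} (s : Finset ι) (δ : ι → Derivation k A A) :
    symbol (∑ i ∈ s, δ i) = ∑ i ∈ s, symbol (δ i) :=
  map_sum ({ toFun := symbol, map_zero' := symbol_zero, map_add' := symbol_add } :
    Derivation k A A →+ Gr k A) δ s

/-- The morphism from the polynomial ring to the graded ring that sends the variables to the symbols
of given derivations. -/
noncomputable def symbolHom {n : ℕ} (d : Fin n → Derivation k A A) :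
    MvPolynomial (Fin n) A →+* Gr k A :=
  eval₂Hom grC fun i => symbol (d i)

/-- Operators of order j + 1 are sums of products (a + δ)Q with Q of order j; modulo order j such a
product is Qδ, so its class is that of Q times the symbol of δ. -/
theorem symbolHom_surjective {n : ℕ} (d : Fin n → Derivation k A A)
    (hd : Submodule.span A (Set.range d) = ⊤) : Function.Surjective (symbolHom d) := by
  rw [← RingHom.range_eq_top, eq_top_iff]
  have hC : ∀ a : A, grC a ∈ (symbolHom d).range := fun a => ⟨C a, by simp [symbolHom]⟩
  have hsymb : ∀ δ : Derivation k A A, symbol δ ∈ (symbolHom d).range := by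
    intro δ
    have hδ : δ ∈ Submodule.span A (Set.range d) := hd ▸ Submodule.mem_top
    induction hδ using Submodule.span_induction with
    | mem x hx =>
      obtain ⟨i, rfl⟩ := hx
      exact ⟨X i, by simp [symbolHom]⟩
    | zero => rw [symbol_zero]; exact zero_mem _
    | add x y _ _ hx hy => rw [symbol_add]; exact add_mem hx hy
    | smul a x _ hx => rw [symbol_smul]; exact mul_mem (hC a) hx
  -- The membership is repeated in the conclusion to make it a predicate of P alone, as the
  -- induction on products requires.
  have hof : ∀ (j : ℕ) (P : Module.End k A), P ∈ orderFil k A j →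
      ∃ hP : P ∈ orderFil k A j,
        DirectSum.of (GrPart k A) j (grMk j ⟨P, hP⟩) ∈ (symbolHom d).range := by
    intro j
    induction j with
    | zero =>
      rintro P ⟨a, rfl⟩
      exact ⟨⟨a, rfl⟩, hC a⟩
    | succ j ih =>
      intro P hP
      refine Submodule.mul_induction_on hP ?_ ?_
      · rintro _ ⟨a, δ, rfl⟩ Q hQ
        refine ⟨Submodule.mul_mem_mul ⟨a, δ, rfl⟩ hQ, ?_⟩
        have h1 : DirectSum.of (GrPart k A) (j + 1) (grMk (j + 1)
            ⟨(LinearMap.mul k A a + (δ : A →ₗ[k] A)) * Q,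
              Submodule.mul_mem_mul ⟨a, δ, rfl⟩ hQ⟩) =
            DirectSum.of (GrPart k A) j (grMk j ⟨Q, hQ⟩) * symbol δ := by
          rw [symbol, DirectSum.of_mul_of]
          refine congrArg (DirectSum.of (GrPart k A) (j + 1)) (grMk_eq _ _ ?_)
          have h2 := commutator_firstOps_orderFil (derivation_mem_firstOps δ) hQ
          have h3 : LinearMap.mul k A a * Q ∈ orderFil k A j :=
            mulOps_mul_orderFil j (Submodule.mul_mem_mul ⟨a, rfl⟩ hQ)
          have h4 := add_mem h3 h2
          rwa [← add_sub_assoc, ← add_mul] at h4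
        rw [h1]
        exact mul_mem (ih Q hQ).2 (hsymb δ)
      · rintro P Q ⟨hP, hP'⟩ ⟨hQ, hQ'⟩
        refine ⟨add_mem hP hQ, ?_⟩
        have := add_mem hP' hQ'
        rwa [← map_add] at this
  intro y _
  induction y using DirectSum.induction_on with
  | zero => exact zero_mem _
  | of j z =>
    obtain ⟨P, rfl⟩ := grMk_surjective j z
    exact (hof j P P.2).2
  | add y z hy hz => exact add_mem (hy trivial) (hz trivial)

theorem commutator_mul_mem_orderFilLT (x : A) {j : ℕ} {P : Module.End k A}
    (hP : P ∈ orderFil k A j) :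
    P * LinearMap.mul k A x - LinearMap.mul k A x * P ∈ orderFilLT k A j :=
  commutator_mem (j := 0) hP ⟨x, rfl⟩

/-- The morphism of degree `-1` of the graded ring induced by the commutator with a function. -/
noncomputable def grBracketPart (x : A) (j : ℕ) : GrPart k A (j + 1) →+ GrPart k A j :=
  QuotientAddGroup.map _ _
    ({ toFun := fun P => ⟨P.1 * LinearMap.mul k A x - LinearMap.mul k A x * P.1,
          commutator_mul_mem_orderFilLT x P.2⟩
       map_zero' := by ext1; simp
       map_add' := fun P Q => by
        ext1
        simp only [Submodule.coe_add, add_mul, mul_add]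
        abel } : orderFil k A (j + 1) →+ orderFil k A j)
    fun _ hP => commutator_mul_mem_orderFilLT x hP

/-- The bracket of the graded ring with a function of degree zero. -/
noncomputable def grBracket (x : A) : Gr k A →+ Gr k A :=
  DirectSum.toAddMonoid fun j => match j with
    | 0 => 0
    | j + 1 => (DirectSum.of (GrPart k A) j).comp (grBracketPart x j)

theorem grBracket_of_zero (x : A) (z : GrPart k A 0) :
    grBracket x (DirectSum.of (GrPart k A) 0 z) = 0 := by
  rw [grBracket, DirectSum.toAddMonoid_of]
  rfl

theorem grBracket_of_succ (x : A) (j : ℕ) (P : orderFil k A (j + 1)) :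
    grBracket x (DirectSum.of (GrPart k A) (j + 1) (grMk (j + 1) P)) =
      DirectSum.of (GrPart k A) j
        (grMk j ⟨P.1 * LinearMap.mul k A x - LinearMap.mul k A x * P.1,
          commutator_mul_mem_orderFilLT x P.2⟩) := by
  rw [grBracket, DirectSum.toAddMonoid_of]
  rfl

/-- The Leibniz rule for [Qδ, x], with [δ, x] = δ(x). -/
theorem grBracket_mul_symbol (x : A) (y : Gr k A) (δ : Derivation k A A) :
    grBracket x (y * symbol δ) = grBracket x y * symbol δ + y * grC (δ x) := by
  induction y using DirectSum.induction_on with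
  | zero => simp
  | add y z hy hz => simp only [add_mul, map_add, hy, hz]; abel
  | of j z =>
    obtain ⟨Q, rfl⟩ := grMk_surjective j z
    have e : (Q : Module.End k A) * (δ : A →ₗ[k] A) * LinearMap.mul k A x -
        LinearMap.mul k A x * (Q * (δ : A →ₗ[k] A)) =
        (Q * LinearMap.mul k A x - LinearMap.mul k A x * Q) * (δ : A →ₗ[k] A) +
          Q * LinearMap.mul k A (δ x) := by
      ext a
      simp [mul_comm]
      abel
    have h2 : DirectSum.of (GrPart k A) j (grMk j Q) * grC (δ x) =
        DirectSum.of (GrPart k A) j (grMk j ⟨Q * LinearMap.mul k A (δ x),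
          mul_mem_orderFil (j := 0) Q.2 ⟨_, rfl⟩⟩) :=
      DirectSum.of_mul_of _ _
    rw [h2, symbol, DirectSum.of_mul_of]
    refine (grBracket_of_succ x j ⟨Q.1 * (δ : A →ₗ[k] A), mul_mem_orderFil Q.2
      (mem_orderFil_one (derivation_mem_firstOps δ))⟩).trans ?_
    -- In degree zero the bracket is zero by definition, and Q commutes with x exactly.
    cases j with
    | zero =>
      refine Eq.trans (b := DirectSum.of (GrPart k A) 0 (grMk 0 ⟨Q * LinearMap.mul k A (δ x),
        mul_mem_orderFil (j := 0) Q.2 ⟨_, rfl⟩⟩)) ?_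
        (by rw [grBracket_of_zero, zero_mul, zero_add])
      refine congrArg (DirectSum.of (GrPart k A) 0) (grMk_eq _ _ ?_)
      have h0 : (Q : Module.End k A) * LinearMap.mul k A x - LinearMap.mul k A x * Q = 0 :=
        commutator_mul_mem_orderFilLT x Q.2
      simp only [e, h0, zero_mul, zero_add, sub_self]
      exact zero_mem _
    | succ j =>
      rw [grBracket_of_succ, DirectSum.of_mul_of, ← map_add (DirectSum.of (GrPart k A) (j + 1))]
      refine congrArg (DirectSum.of (GrPart k A) (j + 1)) (grMk_eq _
        (⟨_, mul_mem_orderFil (commutator_mul_mem_orderFilLT x Q.2)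
          (mem_orderFil_one (derivation_mem_firstOps δ))⟩ + ⟨Q * LinearMap.mul k A (δ x),
          mul_mem_orderFil (j := 0) Q.2 ⟨_, rfl⟩⟩) ?_)
      simp only [e, Submodule.coe_add, sub_self]
      exact zero_mem _

theorem grBracket_symbolHom {n : ℕ} (d : Fin n → Derivation k A A) (x : Fin n → A)
    (hdx : ∀ i j, d i (x j) = if i = j then 1 else 0) (i : Fin n) (F : MvPolynomial (Fin n) A) :
    grBracket (x i) (symbolHom d F) = symbolHom d (pderiv i F) := by
  induction F using MvPolynomial.induction_on with
  | C a =>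
    rw [pderiv_C, map_zero, symbolHom, coe_eval₂Hom, eval₂_C]
    exact grBracket_of_zero _ _
  | add p q hp hq => simp only [map_add, hp, hq]
  | mul_X p j hp =>
    have hX : symbolHom d (X j) = symbol (d j) := by simp [symbolHom]
    have hC : ∀ a, symbolHom d (C a) = grC a := by simp [symbolHom]
    rw [map_mul, hX, grBracket_mul_symbol, hp, hdx, pderiv_mul, map_add, map_mul, map_mul, hX,
      ← hC]
    congr 2
    by_cases hij : j = i
    · subst hij
      simp
    · simp [hij, pderiv_X_of_ne hij]

theorem mul_symbol_apply_zero (y : Gr k A) (δ : Derivation k A A) : (y * symbol δ) 0 = 0 := by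
  induction y using DirectSum.induction_on with
  | zero => rw [zero_mul]; rfl
  | add y z hy hz => rw [add_mul, DirectSum.add_apply, hy, hz, add_zero]
  | of j z =>
    rw [symbol, DirectSum.of_mul_of, DirectSum.of_eq_of_ne]
    omega

theorem symbolHom_apply_zero {n : ℕ} (d : Fin n → Derivation k A A)
    (F : MvPolynomial (Fin n) A) : symbolHom d F 0 = grC (k := k) (constantCoeff F) 0 := by
  induction F using MvPolynomial.induction_on with
  | C a => simp [symbolHom]
  | add p q hp hq => simp only [map_add, DirectSum.add_apply, hp, hq]
  | mul_X p j hp =>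
    have hX : symbolHom d (X j) = symbol (d j) := by simp [symbolHom]
    rw [map_mul, hX, mul_symbol_apply_zero]
    simp

theorem grC_apply_zero_eq_zero {a : A} (h : grC (k := k) a 0 = 0) : a = 0 := by
  have h1 : grMk 0 ⟨LinearMap.mul k A a, a, rfl⟩ = grMk (k := k) (A := A) 0 0 := by
    rw [← DirectSum.of_eq_same (β := GrPart k A) 0 (grMk 0 ⟨LinearMap.mul k A a, a, rfl⟩)]
    exact h
  have h2 := grMk_eq_iff.1 h1
  have h3 : LinearMap.mul k A a - 0 = 0 := h2
  simpa using LinearMap.congr_fun h3 1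

/-- The kernel is stable under all ∂/∂ξᵢ, which are brackets with the xᵢ. Differentiating lowers any
coefficient to a constant term, up to a nonzero integer factor, and constant terms are detected in
degree zero. -/
theorem symbolHom_injective [NoZeroDivisors A] [CharZero A] {n : ℕ} (d : Fin n → Derivation k A A)
    (x : Fin n → A) (hdx : ∀ i j, d i (x j) = if i = j then 1 else 0) :
    Function.Injective (symbolHom d) := by
  have key : ∀ (N : ℕ) (m : Fin n →₀ ℕ), m.degree = N →
      ∀ F, symbolHom d F = 0 → coeff m F = 0 := by
    intro N
    induction N with
    | zero =>
      intro m hm F hF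
      have : m = 0 := (Finsupp.degree_eq_zero_iff m).1 hm
      subst this
      apply grC_apply_zero_eq_zero (k := k)
      rw [← constantCoeff_eq, ← symbolHom_apply_zero d, hF]
      rfl
    | succ N ih =>
      intro m hm F hF
      have hm0 : m ≠ 0 := by
        rintro rfl
        simp at hm
      obtain ⟨i, hi⟩ := Finsupp.ne_iff.1 hm0
      have hle : Finsupp.single i 1 ≤ m := by
        rw [Finsupp.single_le_iff]
        exact Nat.one_le_iff_ne_zero.2 hi
      obtain ⟨m', rfl⟩ := exists_add_of_le hle
      have h1 := ih m' (by simp at hm; omega) (pderiv i F) (by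
        rw [← grBracket_symbolHom d x hdx, hF, map_zero])
      rw [add_comm]
      rw [coeff_pderiv] at h1
      refine (mul_eq_zero.1 h1).resolve_right ?_
      exact_mod_cast Nat.succ_ne_zero (m' i)
  rw [injective_iff_map_eq_zero]
  intro F hF
  ext m
  rw [coeff_zero]
  exact key _ m rfl F hF

end GradedRing

/-! ### Convergent power series -/

section Weights

open MvPowerSeries ENNReal

variable {n : ℕ}

/-- A multiplicative and injective numbering of the monomials: the exponents are read off from the
prime factorization. It orders the monomials and gives weights to them. -/
noncomputable def monomialCode (α : Fin n →₀ ℕ) : ℕ :=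
  ∏ i : Fin n, Nat.nth Nat.Prime i ^ α i

theorem prime_nth (i : ℕ) : (Nat.nth Nat.Prime i).Prime :=
  Nat.nth_mem_of_infinite Nat.infinite_setOfPred_prime i

@[simp]
theorem monomialCode_zero : monomialCode (0 : Fin n →₀ ℕ) = 1 := by
  simp [monomialCode]

theorem monomialCode_add (α β : Fin n →₀ ℕ) :
    monomialCode (α + β) = monomialCode α * monomialCode β := by
  simp [monomialCode, pow_add, Finset.prod_mul_distrib]

theorem monomialCode_pos (α : Fin n →₀ ℕ) : 0 < monomialCode α :=
  Finset.prod_pos fun i _ => pow_pos (prime_nth i).pos _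

theorem factorization_monomialCode (α : Fin n →₀ ℕ) (i : Fin n) :
    (monomialCode α).factorization (Nat.nth Nat.Prime i) = α i := by
  rw [monomialCode, Nat.factorization_prod (g := fun j : Fin n => Nat.nth Nat.Prime j ^ α j)
    fun j _ => (pow_pos (prime_nth j).pos _).ne']
  rw [Finsupp.coe_finsetSum, Finset.sum_apply, Finset.sum_eq_single i]
  · rw [(prime_nth i).factorization_pow, Finsupp.single_eq_same]
  · intro j _ hj
    rw [(prime_nth j).factorization_pow, Finsupp.single_eq_of_ne]
    intro h
    exact hj (Fin.ext (Nat.nth_injective Nat.infinite_setOfPred_prime h.symm))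
  · simp

theorem monomialCode_injective : Function.Injective (monomialCode (n := n)) := fun α β h => by
  ext i
  rw [← factorization_monomialCode α, h, factorization_monomialCode]

/-- The weight of a monomial. -/
noncomputable def weight (t : ℕ) (α : Fin n →₀ ℕ) : ℝ≥0∞ :=
  ((monomialCode α : ℝ≥0∞)⁻¹) ^ t

theorem weight_add (t : ℕ) (α β : Fin n →₀ ℕ) :
    weight t (α + β) = weight t α * weight t β := by
  rw [weight, weight, weight, monomialCode_add, Nat.cast_mul, ENNReal.mul_inv, mul_pow]
  · simp
  · simp

theorem weight_le_of_le {s t : ℕ} (h : s ≤ t) (α : Fin n →₀ ℕ) : weight t α ≤ weight s α :=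
  pow_le_pow_right_of_le_one' (ENNReal.inv_le_one.2 (by exact_mod_cast monomialCode_pos α)) h

theorem weight_ne_zero (t : ℕ) (α : Fin n →₀ ℕ) : weight t α ≠ 0 :=
  pow_ne_zero _ (ENNReal.inv_ne_zero.2 (ENNReal.natCast_ne_top _))

theorem weight_ne_top (t : ℕ) (α : Fin n →₀ ℕ) : weight t α ≠ ⊤ :=
  ENNReal.pow_ne_top (ENNReal.inv_ne_top.2 (Nat.cast_ne_zero.2 (monomialCode_pos α).ne'))

/-- The weighted `ℓ¹`-norm of a power series. -/
noncomputable def wnorm (t : ℕ) (φ : MvPowerSeries (Fin n) ℂ) : ℝ≥0∞ :=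
  ∑' α, ‖coeff α φ‖ₑ * weight t α

theorem wnorm_le_of_le {s t : ℕ} (h : s ≤ t) (φ : MvPowerSeries (Fin n) ℂ) :
    wnorm t φ ≤ wnorm s φ :=
  ENNReal.tsum_le_tsum fun α => mul_le_mul_right (weight_le_of_le h α) _

theorem wnorm_add (t : ℕ) (φ ψ : MvPowerSeries (Fin n) ℂ) :
    wnorm t (φ + ψ) ≤ wnorm t φ + wnorm t ψ := by
  rw [wnorm, wnorm, wnorm, ← ENNReal.tsum_add]
  refine ENNReal.tsum_le_tsum fun α => ?_
  rw [map_add, ← add_mul]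
  exact mul_le_mul_left (enorm_add_le _ _) _

theorem wnorm_sum {ι : Type*} (t : ℕ) (s : Finset ι) (φ : ι → MvPowerSeries (Fin n) ℂ) :
    wnorm t (∑ i ∈ s, φ i) ≤ ∑ i ∈ s, wnorm t (φ i) := by
  classical
  induction s using Finset.induction_on with
  | empty => simp [wnorm]
  | insert a s ha ih =>
    rw [Finset.sum_insert ha, Finset.sum_insert ha]
    exact (wnorm_add _ _ _).trans (add_le_add_right ih _)

theorem wnorm_monomial (t : ℕ) (α : Fin n →₀ ℕ) (c : ℂ) :
    wnorm t (monomial α c) = ‖c‖ₑ * weight t α := by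
  classical
  rw [wnorm, tsum_eq_single α]
  · rw [coeff_monomial_same]
  · intro β hβ
    rw [coeff_monomial_ne hβ]
    simp

theorem wnorm_mul (t : ℕ) (φ ψ : MvPowerSeries (Fin n) ℂ) :
    wnorm t (φ * ψ) ≤ wnorm t φ * wnorm t ψ := by
  classical
  have h1 : wnorm t φ * wnorm t ψ = ∑' p : (Fin n →₀ ℕ) × (Fin n →₀ ℕ),
      (‖coeff p.1 φ‖ₑ * weight t p.1) * (‖coeff p.2 ψ‖ₑ * weight t p.2) := by
    rw [ENNReal.tsum_prod']
    simp_rw [ENNReal.tsum_mul_left, ENNReal.tsum_mul_right]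
    rfl
  rw [h1, ← Finset.HasAntidiagonal.sigmaAntidiagonalEquivProd.tsum_eq, ENNReal.tsum_sigma']
  refine ENNReal.tsum_le_tsum fun α => ?_
  rw [coeff_mul]
  refine (mul_le_mul_left (enorm_sum_le _ _) _).trans ?_
  rw [Finset.sum_mul, tsum_fintype, ← Finset.sum_coe_sort]
  refine Finset.sum_le_sum fun p _ => ?_
  have hp : p.1.1 + p.1.2 = α := Finset.HasAntidiagonal.mem_antidiagonal.1 p.2
  change _ ≤ ‖coeff p.1.1 φ‖ₑ * weight t p.1.1 * (‖coeff p.1.2 ψ‖ₑ * weight t p.1.2)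
  rw [enorm_mul, show weight t α = weight t p.1.1 * weight t p.1.2 by rw [← weight_add, hp]]
  exact (mul_mul_mul_comm _ _ _ _).le

/-- The ring of convergent power series. -/
noncomputable def convSeries (n : ℕ) : Subalgebra ℂ (MvPowerSeries (Fin n) ℂ) where
  carrier := {φ | ∃ t, wnorm t φ ≠ ⊤}
  mul_mem' := by
    rintro φ ψ ⟨s, hs⟩ ⟨t, ht⟩
    refine ⟨max s t, ne_top_of_le_ne_top (ENNReal.mul_ne_top hs ht) ((wnorm_mul _ _ _).trans
      (mul_le_mul' (wnorm_le_of_le (le_max_left s t) _) (wnorm_le_of_le (le_max_right s t) _)))⟩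
  add_mem' := by
    rintro φ ψ ⟨s, hs⟩ ⟨t, ht⟩
    refine ⟨max s t, ne_top_of_le_ne_top (ENNReal.add_ne_top.2 ⟨hs, ht⟩) ((wnorm_add _ _ _).trans
      (add_le_add (wnorm_le_of_le (le_max_left s t) _) (wnorm_le_of_le (le_max_right s t) _)))⟩
  algebraMap_mem' c := ⟨0, by
    have : algebraMap ℂ (MvPowerSeries (Fin n) ℂ) c = monomial 0 c := rfl
    rw [this, wnorm_monomial]
    exact ENNReal.mul_ne_top enorm_ne_top (weight_ne_top _ _)⟩

theorem monomial_mem_convSeries (α : Fin n →₀ ℕ) (c : ℂ) : monomial α c ∈ convSeries n :=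
  ⟨0, by rw [wnorm_monomial]; exact ENNReal.mul_ne_top enorm_ne_top (weight_ne_top _ _)⟩

theorem exists_forall_wnorm_ne_top {φ : MvPowerSeries (Fin n) ℂ} (h : φ ∈ convSeries n) :
    ∃ t₀, ∀ t ≥ t₀, wnorm t φ ≠ ⊤ := by
  obtain ⟨t₀, h₀⟩ := h
  exact ⟨t₀, fun t ht => ne_top_of_le_ne_top h₀ (wnorm_le_of_le ht φ)⟩

/-- A convergent series all of whose monomials come after a given one is dominated by that monomial
in the norms of high weight. -/
theorem exists_forall_wnorm_le {φ : MvPowerSeries (Fin n) ℂ} (h : φ ∈ convSeries n)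
    {α : Fin n →₀ ℕ} (hα : ∀ β, monomialCode β ≤ monomialCode α → coeff β φ = 0)
    {ε : ℝ≥0∞} (hε : ε ≠ 0) : ∃ t₀, ∀ t ≥ t₀, wnorm t φ ≤ ε * weight t α := by
  obtain ⟨s, hs⟩ := h
  -- The monomials of φ have code at least code(α) + 1. Raising t by u thus shrinks the norm of φ by
  -- at least (code(α) + 1)^u and the weight of α by code(α)^u only, so the quotient is bounded by a
  -- constant times r^u.
  let r : ℝ≥0∞ := ((monomialCode α + 1 : ℕ) : ℝ≥0∞)⁻¹ * monomialCode α
  have hr : r < 1 := by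
    simp only [r]
    rw [← ENNReal.div_eq_inv_mul]
    refine ENNReal.div_lt_of_lt_mul ?_
    rw [one_mul]
    exact_mod_cast Nat.lt_succ_self _
  have hlim := ENNReal.Tendsto.const_mul (ENNReal.tendsto_pow_atTop_nhds_zero_of_lt_one hr)
    (Or.inr (ENNReal.mul_ne_top hs (ENNReal.inv_ne_top.2 (weight_ne_zero s α))))
  rw [mul_zero] at hlim
  obtain ⟨u₀, hu₀⟩ := Filter.eventually_atTop.1 (hlim.eventually (ge_mem_nhds hε.bot_lt))
  refine ⟨s + u₀, fun t ht => ?_⟩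
  obtain ⟨u, rfl⟩ := Nat.exists_eq_add_of_le ht
  have h1 : wnorm (s + u₀ + u) φ ≤
      wnorm s φ * (((monomialCode α + 1 : ℕ) : ℝ≥0∞)⁻¹) ^ (u₀ + u) := by
    rw [wnorm, wnorm, ← ENNReal.tsum_mul_right]
    refine ENNReal.tsum_le_tsum fun β => ?_
    by_cases hβ : monomialCode β ≤ monomialCode α
    · simp [hα β hβ]
    · rw [mul_assoc, weight, weight, add_assoc, pow_add]
      refine mul_le_mul_right (mul_le_mul_right ?_ _) _
      refine pow_le_pow_left' (ENNReal.inv_le_inv.2 ?_) _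
      exact_mod_cast Nat.lt_of_not_le hβ
  refine h1.trans ?_
  have h2 := hu₀ (u₀ + u) (Nat.le_add_right _ _)
  have h3 := mul_le_mul_left h2 (weight (s + u₀ + u) α)
  refine le_trans (le_of_eq ?_) h3
  have h4 : weight (s + u₀ + u) α = weight s α * ((monomialCode α : ℝ≥0∞)⁻¹) ^ (u₀ + u) := by
    rw [weight, weight, add_assoc, pow_add]
  have h5 : (monomialCode α : ℝ≥0∞) * (monomialCode α : ℝ≥0∞)⁻¹ = 1 :=
    ENNReal.mul_inv_cancel (by exact_mod_cast (monomialCode_pos α).ne') (ENNReal.natCast_ne_top _)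
  rw [h4, mul_pow]
  calc _ = wnorm s φ * ((weight s α)⁻¹ * weight s α) *
        (((monomialCode α + 1 : ℕ) : ℝ≥0∞)⁻¹ ^ (u₀ + u) *
          ((monomialCode α : ℝ≥0∞) * (monomialCode α : ℝ≥0∞)⁻¹) ^ (u₀ + u)) := by
        rw [h5, ENNReal.inv_mul_cancel (weight_ne_zero s α) (weight_ne_top s α), one_pow, mul_one,
          mul_one]
    _ = _ := by rw [mul_pow]; ring

end Weights

/-! ### The division theorem for convergent power series -/

section Division

open MvPowerSeries ENNReal

variable {n : ℕ} {ι : Type*}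

section Quotient

variable [DecidableEq ι]

/-- The series of the terms of `φ` whose exponents are assigned to `i` by `s`, divided by the
monomial of exponent `α`. -/
noncomputable def quotTerm (s : (Fin n →₀ ℕ) → Option ι) (α : Fin n →₀ ℕ) (i : ι) :
    MvPowerSeries (Fin n) ℂ →ₗ[ℂ] MvPowerSeries (Fin n) ℂ where
  toFun φ := fun γ => if s (γ + α) = some i then coeff (γ + α) φ else 0
  map_add' φ ψ := by
    ext γ
    change (if _ then coeff _ (φ + ψ) else 0) =
      (if _ then coeff _ φ else 0) + (if _ then coeff _ ψ else 0)
    split_ifs <;> simp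
  map_smul' c φ := by
    ext γ
    change (if _ then coeff _ (c • φ) else 0) = c • (if _ then coeff _ φ else 0)
    split_ifs <;> simp

theorem coeff_quotTerm (s : (Fin n →₀ ℕ) → Option ι) (α : Fin n →₀ ℕ) (i : ι)
    (φ : MvPowerSeries (Fin n) ℂ) (γ : Fin n →₀ ℕ) :
    coeff γ (quotTerm s α i φ) = if s (γ + α) = some i then coeff (γ + α) φ else 0 := rfl

/-- Weights are multiplicative and γ ↦ γ + α is injective, so the left side is a partial sum of the
right one. -/
theorem wnorm_quotTerm_mul_weight_le (s : (Fin n →₀ ℕ) → Option ι) (α : Fin n →₀ ℕ) (i : ι)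
    (t : ℕ) (φ : MvPowerSeries (Fin n) ℂ) :
    wnorm t (quotTerm s α i φ) * weight t α ≤ wnorm t φ := by
  rw [wnorm, ← ENNReal.tsum_mul_right]
  refine le_trans (ENNReal.tsum_le_tsum fun γ => ?_)
    (ENNReal.tsum_comp_le_tsum_of_injective (add_left_injective α)
      fun β => ‖coeff β φ‖ₑ * weight t β)
  rw [coeff_quotTerm, mul_assoc, ← weight_add]
  split_ifs
  · exact le_rfl
  · simp

end Quotient

/-- The remainder: the series of the terms of `φ` whose exponents are not assigned. -/
noncomputable def remTerm (s : (Fin n →₀ ℕ) → Option ι) (φ : MvPowerSeries (Fin n) ℂ) :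
    MvPowerSeries (Fin n) ℂ :=
  fun γ => if s γ = none then coeff γ φ else 0

theorem coeff_remTerm (s : (Fin n →₀ ℕ) → Option ι) (φ : MvPowerSeries (Fin n) ℂ)
    (γ : Fin n →₀ ℕ) : coeff γ (remTerm s φ) = if s γ = none then coeff γ φ else 0 := rfl

theorem wnorm_remTerm_le (s : (Fin n →₀ ℕ) → Option ι) (t : ℕ) (φ : MvPowerSeries (Fin n) ℂ) :
    wnorm t (remTerm s φ) ≤ wnorm t φ := by
  refine ENNReal.tsum_le_tsum fun γ => ?_
  rw [coeff_remTerm]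
  split_ifs
  · exact le_rfl
  · simp

variable [Fintype ι] [DecidableEq ι]

theorem sum_quotTerm_mul_add_remTerm (s : (Fin n →₀ ℕ) → Option ι) (α : ι → Fin n →₀ ℕ)
    (hs : ∀ β i, s β = some i → α i ≤ β) (φ : MvPowerSeries (Fin n) ℂ) :
    ∑ i, quotTerm s (α i) i φ * monomial (α i) 1 + remTerm s φ = φ := by
  ext β
  rw [map_add, map_sum, coeff_remTerm]
  have h : ∀ i, coeff β (quotTerm s (α i) i φ * monomial (α i) 1) =
      if s β = some i then coeff β φ else 0 := by
    intro i
    rw [coeff_mul_monomial, mul_one]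
    split_ifs with h1 h2 h2
    · rw [coeff_quotTerm, tsub_add_cancel_of_le h1, if_pos h2]
    · rw [coeff_quotTerm, tsub_add_cancel_of_le h1, if_neg h2]
    · exact absurd (hs β i h2) h1
    · rfl
  simp only [h]
  cases hβ : s β with
  | none => simp
  | some i => simp

/-- The operator of the division algorithm. -/
noncomputable def divStep (s : (Fin n →₀ ℕ) → Option ι) (α : ι → Fin n →₀ ℕ)
    (τ : ι → MvPowerSeries (Fin n) ℂ) : Module.End ℂ (MvPowerSeries (Fin n) ℂ) :=
  ∑ i, (LinearMap.mulRight ℂ (τ i)).comp (quotTerm s (α i) i)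

theorem divStep_apply (s : (Fin n →₀ ℕ) → Option ι) (α : ι → Fin n →₀ ℕ)
    (τ : ι → MvPowerSeries (Fin n) ℂ) (φ : MvPowerSeries (Fin n) ℂ) :
    divStep s α τ φ = ∑ i, quotTerm s (α i) i φ * τ i := by
  simp [divStep]

/-- Dividing by x ^ αᵢ costs the inverse of its weight, which the smallness of τᵢ repays. The
constant makes the sum over ι at most one half; the + 1 keeps it finite when ι is empty. -/
theorem wnorm_divStep_le (s : (Fin n →₀ ℕ) → Option ι) (α : ι → Fin n →₀ ℕ)
    (τ : ι → MvPowerSeries (Fin n) ℂ) (t : ℕ)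
    (hτ : ∀ i, wnorm t (τ i) ≤ (2 * (Fintype.card ι + 1 : ℕ) : ℝ≥0∞)⁻¹ * weight t (α i))
    (φ : MvPowerSeries (Fin n) ℂ) : wnorm t (divStep s α τ φ) ≤ 2⁻¹ * wnorm t φ := by
  rw [divStep_apply]
  refine (wnorm_sum _ _ _).trans ?_
  have h : ∀ i, wnorm t (quotTerm s (α i) i φ * τ i) ≤
      (2 * (Fintype.card ι + 1 : ℕ) : ℝ≥0∞)⁻¹ * wnorm t φ := fun i => by
    refine (wnorm_mul _ _ _).trans ((mul_le_mul_right (hτ i) _).trans ?_)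
    rw [mul_left_comm]
    exact mul_le_mul_right (wnorm_quotTerm_mul_weight_le _ _ _ _ _) _
  refine (Finset.sum_le_sum fun i _ => h i).trans ?_
  rw [Finset.sum_const, nsmul_eq_mul, ← mul_assoc, Finset.card_univ]
  refine mul_le_mul_left ?_ _
  rw [ENNReal.mul_inv (by simp) (by simp), mul_left_comm]
  refine mul_le_of_le_one_right' ?_
  rw [← div_eq_mul_inv]
  exact ENNReal.div_le_of_le_mul (by rw [one_mul]; exact_mod_cast Nat.le_succ _)

/-- Replacing x ^ αᵢ by τᵢ, whose exponents have larger codes, strictly raises the code of every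
term. -/
theorem coeff_divStep_eq_zero (s : (Fin n →₀ ℕ) → Option ι) (α : ι → Fin n →₀ ℕ)
    (τ : ι → MvPowerSeries (Fin n) ℂ)
    (hτ : ∀ i β, monomialCode β ≤ monomialCode (α i) → coeff β (τ i) = 0) (j : ℕ)
    {φ : MvPowerSeries (Fin n) ℂ} (hφ : ∀ β, monomialCode β ≤ j → coeff β φ = 0)
    (β : Fin n →₀ ℕ) (hβ : monomialCode β ≤ j + 1) : coeff β (divStep s α τ φ) = 0 := by
  classical
  rw [divStep_apply, map_sum]
  refine Finset.sum_eq_zero fun i _ => ?_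
  rw [coeff_mul]
  refine Finset.sum_eq_zero fun p hp => ?_
  have hp : p.1 + p.2 = β := Finset.HasAntidiagonal.mem_antidiagonal.1 hp
  rw [coeff_quotTerm]
  by_cases h1 : monomialCode p.2 ≤ monomialCode (α i)
  · rw [hτ i _ h1, mul_zero]
  · rw [hφ, ite_self, zero_mul]
    rw [monomialCode_add]
    rw [← hp, monomialCode_add] at hβ
    have h2 : monomialCode p.1 * monomialCode (α i) < monomialCode p.1 * monomialCode p.2 :=
      Nat.mul_lt_mul_of_pos_left (not_le.1 h1) (monomialCode_pos _)
    omega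

/-- Codes are positive, so the case j = 0 is vacuous. This makes each coefficient of the Neumann
series a finite sum. -/
theorem coeff_divStep_pow_eq_zero (s : (Fin n →₀ ℕ) → Option ι) (α : ι → Fin n →₀ ℕ)
    (τ : ι → MvPowerSeries (Fin n) ℂ)
    (hτ : ∀ i β, monomialCode β ≤ monomialCode (α i) → coeff β (τ i) = 0) (j : ℕ)
    (φ : MvPowerSeries (Fin n) ℂ) (β : Fin n →₀ ℕ) (hβ : monomialCode β ≤ j) :
    coeff β ((divStep s α τ ^ j) φ) = 0 := by
  induction j generalizing β with
  | zero => exact absurd (monomialCode_pos β) (by omega)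
  | succ j ih =>
    rw [pow_succ', Module.End.mul_apply]
    exact coeff_divStep_eq_zero s α τ hτ j ih β hβ

/-- The sum of the Neumann series of the division algorithm. -/
noncomputable def divSum (s : (Fin n →₀ ℕ) → Option ι) (α : ι → Fin n →₀ ℕ)
    (τ : ι → MvPowerSeries (Fin n) ℂ) (φ : MvPowerSeries (Fin n) ℂ) : MvPowerSeries (Fin n) ℂ :=
  fun β => ∑ j ∈ Finset.range (monomialCode β), coeff β ((divStep s α τ ^ j) φ)

theorem coeff_divSum (s : (Fin n →₀ ℕ) → Option ι) (α : ι → Fin n →₀ ℕ)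
    (τ : ι → MvPowerSeries (Fin n) ℂ)
    (hτ : ∀ i β, monomialCode β ≤ monomialCode (α i) → coeff β (τ i) = 0)
    (φ : MvPowerSeries (Fin n) ℂ) (β : Fin n →₀ ℕ) {J : ℕ} (hJ : monomialCode β ≤ J) :
    coeff β (divSum s α τ φ) = coeff β (∑ j ∈ Finset.range J, (divStep s α τ ^ j) φ) := by
  rw [map_sum]
  refine Finset.sum_subset (Finset.range_subset_range.2 hJ) fun j _ hj => ?_
  exact coeff_divStep_pow_eq_zero s α τ hτ j φ β (by simpa using hj)

theorem divSum_sub_divStep (s : (Fin n →₀ ℕ) → Option ι) (α : ι → Fin n →₀ ℕ)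
    (τ : ι → MvPowerSeries (Fin n) ℂ)
    (hτ : ∀ i β, monomialCode β ≤ monomialCode (α i) → coeff β (τ i) = 0)
    (φ : MvPowerSeries (Fin n) ℂ) :
    divSum s α τ φ - divStep s α τ (divSum s α τ φ) = φ := by
  ext β
  set J := monomialCode β with hJ
  set S := ∑ j ∈ Finset.range J, (divStep s α τ ^ j) φ with hS
  have h1 : coeff β (divStep s α τ (divSum s α τ φ - S)) = 0 := by
    refine coeff_divStep_eq_zero s α τ hτ J (fun γ hγ => ?_) β (by omega)
    rw [map_sub, coeff_divSum s α τ hτ φ γ hγ, sub_self]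
  rw [map_sub, map_sub, sub_eq_zero] at h1
  have h2 : divStep s α τ S + φ = ∑ j ∈ Finset.range (J + 1), (divStep s α τ ^ j) φ := by
    rw [Finset.sum_range_succ', hS, map_sum]
    simp only [pow_succ', Module.End.mul_apply, pow_zero, Module.End.one_apply]
  rw [map_sub, h1, coeff_divSum s α τ hτ φ β (Nat.le_succ J), ← h2, map_add]
  ring

theorem wnorm_divSum_le (s : (Fin n →₀ ℕ) → Option ι) (α : ι → Fin n →₀ ℕ)
    (τ : ι → MvPowerSeries (Fin n) ℂ) (t : ℕ)
    (hτ : ∀ i, wnorm t (τ i) ≤ (2 * (Fintype.card ι + 1 : ℕ) : ℝ≥0∞)⁻¹ * weight t (α i))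
    (φ : MvPowerSeries (Fin n) ℂ) : wnorm t (divSum s α τ φ) ≤ 2 * wnorm t φ := by
  have hpow : ∀ j, wnorm t ((divStep s α τ ^ j) φ) ≤ 2⁻¹ ^ j * wnorm t φ := by
    intro j
    induction j with
    | zero => simp
    | succ j ih =>
      rw [pow_succ', Module.End.mul_apply, pow_succ', mul_assoc]
      exact (wnorm_divStep_le s α τ t hτ _).trans (mul_le_mul_right ih _)
  calc wnorm t (divSum s α τ φ)
      ≤ ∑' β, ∑' j, ‖coeff β ((divStep s α τ ^ j) φ)‖ₑ * weight t β := by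
        refine ENNReal.tsum_le_tsum fun β => ?_
        rw [ENNReal.tsum_mul_right]
        refine mul_le_mul_left ?_ _
        exact (enorm_sum_le (Finset.range (monomialCode β)) fun j => coeff β ((divStep s α τ ^ j) φ)).trans (ENNReal.sum_le_tsum _)
    _ = ∑' j, wnorm t ((divStep s α τ ^ j) φ) := ENNReal.tsum_comm
    _ ≤ ∑' j, 2⁻¹ ^ j * wnorm t φ := ENNReal.tsum_le_tsum hpow
    _ = 2 * wnorm t φ := by rw [ENNReal.tsum_mul_right, ENNReal.tsum_geometric_two]

/-- The division theorem: modulo series `fᵢ` with initial monomials `x ^ αᵢ`, every convergent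
series is congruent to one without monomials divisible by an `x ^ αᵢ`. -/
theorem exists_division (f : ι → convSeries n) (α : ι → Fin n →₀ ℕ)
    (hα : ∀ i, coeff (α i) (f i).1 = 1)
    (hf : ∀ i β, monomialCode β < monomialCode (α i) → coeff β (f i).1 = 0) (g : convSeries n) :
    ∃ (q : ι → convSeries n) (r : convSeries n), g = ∑ i, q i * f i + r ∧
      ∀ i β, α i ≤ β → coeff β r.1 = 0 := by
  classical
  let s : (Fin n →₀ ℕ) → Option ι := fun β =>
    if h : ∃ i, α i ≤ β then some h.choose else none
  have hs : ∀ β i, s β = some i → α i ≤ β := by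
    intro β i h
    by_cases h' : ∃ i, α i ≤ β
    · simp only [s, dif_pos h', Option.some.injEq] at h
      exact h ▸ h'.choose_spec
    · simp [s, dif_neg h'] at h
  have hs' : ∀ i β, α i ≤ β → s β ≠ none := by
    intro i β h
    simp [s, dif_pos (⟨i, h⟩ : ∃ i, α i ≤ β)]
  let τ : ι → MvPowerSeries (Fin n) ℂ := fun i => monomial (α i) 1 - (f i).1
  have hτmem : ∀ i, τ i ∈ convSeries n := fun i =>
    sub_mem (monomial_mem_convSeries _ _) (f i).2
  have hτ : ∀ i β, monomialCode β ≤ monomialCode (α i) → coeff β (τ i) = 0 := by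
    intro i β h
    rw [map_sub]
    by_cases hβ : β = α i
    · rw [hβ, coeff_monomial_same, hα, sub_self]
    · rw [coeff_monomial_ne hβ, hf i β (lt_of_le_of_ne h fun e => hβ (monomialCode_injective e)),
        sub_self]
  have hex : ∀ i, ∃ t₀, ∀ t ≥ t₀, wnorm t (τ i) ≤
      (2 * (Fintype.card ι + 1 : ℕ) : ℝ≥0∞)⁻¹ * weight t (α i) := fun i =>
    exists_forall_wnorm_le (hτmem i) (hτ i)
      (ENNReal.inv_ne_zero.2 (ENNReal.mul_ne_top (by simp) (by simp)))
  choose t₀ ht₀ using hex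
  obtain ⟨t₁, ht₁⟩ := exists_forall_wnorm_ne_top g.2
  let t := max t₁ (Finset.univ.sup t₀)
  have htτ : ∀ i, wnorm t (τ i) ≤
      (2 * (Fintype.card ι + 1 : ℕ) : ℝ≥0∞)⁻¹ * weight t (α i) := fun i =>
    ht₀ i t ((Finset.le_sup (Finset.mem_univ i)).trans (le_max_right _ _))
  let G := divSum s α τ g.1
  have hG : wnorm t G ≠ ⊤ := ne_top_of_le_ne_top
    (ENNReal.mul_ne_top (by simp) (ht₁ t (le_max_left _ _))) (wnorm_divSum_le s α τ t htτ g.1)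
  have hq : ∀ i, quotTerm s (α i) i G ∈ convSeries n := fun i => ⟨t, fun h => by
    have := wnorm_quotTerm_mul_weight_le s (α i) i t G
    rw [h, ENNReal.top_mul (weight_ne_zero _ _), top_le_iff] at this
    exact hG this⟩
  have hr : remTerm s G ∈ convSeries n := ⟨t, ne_top_of_le_ne_top hG (wnorm_remTerm_le s t G)⟩
  refine ⟨fun i => ⟨_, hq i⟩, ⟨_, hr⟩, ?_, ?_⟩
  · apply Subtype.ext
    -- If G = ∑ qᵢ x ^ αᵢ + r, subtracting the division step ∑ qᵢ τᵢ turns each x ^ αᵢ into fᵢ, and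
    -- G was chosen so that the difference is g.
    have h1 := divSum_sub_divStep s α τ hτ g.1
    have h2 := sum_quotTerm_mul_add_remTerm s α hs G
    rw [divStep_apply] at h1
    simp only [AddMemClass.coe_add, AddSubmonoidClass.coe_finsetSum, MulMemClass.coe_mul]
    rw [← h1]
    change G - _ = _
    nth_rewrite 1 [← h2]
    simp only [τ, mul_sub, Finset.sum_sub_distrib]
    change _ - (_ - ∑ i, quotTerm s (α i) i G * (f i).1) = _
    abel
  · intro i β h
    rw [coeff_remTerm, if_neg (hs' i β h)]

end Division

/-! ### The ring of convergent power series: noetherian, local, regular -/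

section ConvergentRing

open MvPowerSeries ENNReal

variable {n : ℕ}

/-- A nonzero series has an initial exponent. -/
theorem exists_initial_exponent {φ : MvPowerSeries (Fin n) ℂ} (hφ : φ ≠ 0) :
    ∃ α, coeff α φ ≠ 0 ∧ ∀ β, monomialCode β < monomialCode α → coeff β φ = 0 := by
  have h : {α | coeff α φ ≠ 0}.Nonempty := by
    by_contra h
    refine hφ (MvPowerSeries.ext fun α => ?_)
    by_contra hα
    exact h ⟨α, hα⟩
  obtain ⟨α, hα, hmin⟩ := WellFounded.has_min (measure (monomialCode (n := n))).wf _ h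
  exact ⟨α, hα, fun β hβ => by_contra fun h' => hmin β h' hβ⟩

instance : IsNoetherianRing (convSeries n) := by
  classical
  refine (isNoetherianRing_iff_ideal_fg _).2 fun I => ?_
  let E : Set (Fin n →₀ ℕ) := {α | ∃ φ ∈ I, coeff α φ.1 = 1 ∧
    ∀ β, monomialCode β < monomialCode α → coeff β φ.1 = 0}
  -- Dickson's lemma: the set E of initial exponents of elements of I has finitely many minimal
  -- elements. Series with these initial exponents generate I, as the remainder of a division by
  -- them has no possible initial exponent.
  have hfin : {α | Minimal (· ∈ E) α}.Finite :=
    WellQuasiOrderedLE.finite_of_isAntichain (setOfPred_minimal_antichain _)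
  let ι := {α // Minimal (· ∈ E) α}
  have : Fintype ι := hfin.fintype
  have hE : ∀ i : ι, i.1 ∈ E := fun i => i.2.prop
  choose f hfI hf1 hf0 using hE
  suffices I = Ideal.span (Set.range f) by
    rw [this]
    exact Submodule.fg_span (Set.finite_range f)
  have hle : Ideal.span (Set.range f) ≤ I := by
    rw [Ideal.span_le]
    rintro _ ⟨i, rfl⟩
    exact hfI i
  refine le_antisymm (fun g hg => ?_) hle
  obtain ⟨q, r, hgr, hr⟩ := exists_division f (fun i => i.1) hf1 hf0 g
  have hsum : ∑ i, q i * f i ∈ Ideal.span (Set.range f) :=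
    Ideal.sum_mem _ fun i _ => Ideal.mul_mem_left _ _ (Ideal.subset_span ⟨i, rfl⟩)
  have hrI : r ∈ I := by
    have : r = g - ∑ i, q i * f i := by rw [hgr]; ring
    rw [this]
    exact sub_mem hg (hle hsum)
  have hr0 : r = 0 := by
    by_contra hne
    obtain ⟨α, hα, hα0⟩ := exists_initial_exponent (φ := r.1) fun h => hne (Subtype.ext h)
    have hαE : α ∈ E := by
      refine ⟨algebraMap ℂ (convSeries n) (coeff α r.1)⁻¹ * r, Ideal.mul_mem_left _ _ hrI, ?_, ?_⟩
      · rw [← Algebra.smul_def]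
        change coeff α ((coeff α r.1)⁻¹ • r.1) = 1
        rw [map_smul, smul_eq_mul, inv_mul_cancel₀ hα]
      · intro β hβ
        rw [← Algebra.smul_def]
        change coeff β ((coeff α r.1)⁻¹ • r.1) = 0
        rw [map_smul, hα0 β hβ, smul_zero]
    obtain ⟨m, hmα, hm⟩ := exists_minimal_le_of_wellFoundedLT (· ∈ E) α hαE
    exact hα (hr ⟨m, hm⟩ α hmα)
  rw [hgr, hr0, add_zero]
  exact hsum

/-- The constant coefficient of a convergent series. -/
noncomputable def convConstCoeff : convSeries n →+* ℂ :=
  (constantCoeff (σ := Fin n) (R := ℂ)).comp (convSeries n).val.toRingHom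

theorem convConstCoeff_apply (φ : convSeries n) : convConstCoeff φ = coeff 0 φ.1 := rfl

@[simp]
theorem convConstCoeff_algebraMap (c : ℂ) :
    convConstCoeff (algebraMap ℂ (convSeries n) c) = c :=
  constantCoeff_C (σ := Fin n) c

/-- Divide 1 by φ, normalized to have constant term 1: its initial exponent 0 lies below every
exponent, so the remainder is zero. -/
theorem isUnit_convSeries_iff {φ : convSeries n} : IsUnit φ ↔ convConstCoeff φ ≠ 0 := by
  refine ⟨fun h => (h.map convConstCoeff).ne_zero, fun h => ?_⟩
  obtain ⟨q, r, hqr, hr⟩ := exists_division (ι := Unit)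
    (fun _ => algebraMap ℂ (convSeries n) (convConstCoeff φ)⁻¹ * φ) (fun _ => 0)
    (fun _ => by
      rw [← convConstCoeff_apply, map_mul, convConstCoeff_algebraMap, inv_mul_cancel₀ h])
    (fun _ β hβ => by
      rw [monomialCode_zero] at hβ
      exact absurd (monomialCode_pos β) (by omega)) 1
  have hr0 : r = 0 := Subtype.ext (MvPowerSeries.ext fun β => hr () β bot_le)
  rw [hr0, add_zero, Finset.univ_unique, Finset.sum_singleton, ← mul_assoc] at hqr
  exact IsUnit.of_mul_eq_one_right _ hqr.symm

instance : IsLocalRing (convSeries n) :=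
  IsLocalRing.of_nonunits_add fun a b ha hb => by
    simp only [mem_nonunits_iff, isUnit_convSeries_iff, not_not] at ha hb ⊢
    rw [map_add, ha, hb, add_zero]

theorem mem_maximalIdeal_convSeries_iff {φ : convSeries n} :
    φ ∈ IsLocalRing.maximalIdeal (convSeries n) ↔ convConstCoeff φ = 0 := by
  rw [IsLocalRing.mem_maximalIdeal, mem_nonunits_iff, isUnit_convSeries_iff, not_not]

/-- The coordinates. -/
noncomputable def coord (i : Fin n) : convSeries n :=
  ⟨X i, monomial_mem_convSeries _ _⟩

theorem coeff_add_single_coord_mul (i : Fin n) (φ : convSeries n) (α : Fin n →₀ ℕ) :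
    coeff (α + Finsupp.single i 1) (coord i * φ).1 = coeff α φ.1 := by
  change coeff (α + Finsupp.single i 1) (monomial (Finsupp.single i 1) 1 * φ.1) = _
  rw [add_comm, coeff_add_monomial_mul, one_mul]

theorem coeff_eq_zero_of_mem_span_coord {J : Set (Fin n)} {φ : convSeries n}
    (h : φ ∈ Ideal.span (coord '' J)) (α : Fin n →₀ ℕ) (hα : ∀ j ∈ J, α j = 0) :
    coeff α φ.1 = 0 := by
  classical
  revert α
  induction h using Submodule.span_induction with
  | mem x hx =>
    obtain ⟨j, hj, rfl⟩ := hx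
    intro α hα
    change coeff α (monomial (Finsupp.single j 1) 1) = 0
    refine coeff_monomial_ne (fun h => ?_) _
    have := hα j hj
    simp [h] at this
  | zero => exact fun α _ => map_zero _
  | add x y _ _ hx hy =>
    intro α hα
    change coeff α (x.1 + y.1) = 0
    rw [map_add, hx α hα, hy α hα, add_zero]
  | smul a x _ hx =>
    intro α hα
    change coeff α (a.1 * x.1) = 0
    rw [coeff_mul]
    refine Finset.sum_eq_zero fun p hp => ?_
    have hp : p.1 + p.2 = α := Finset.HasAntidiagonal.mem_antidiagonal.1 hp
    rw [hx p.2, mul_zero]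
    intro j hj
    have := hα j hj
    rw [← hp, Finsupp.add_apply] at this
    omega

/-- Division by the coordinates in J leaves a remainder free of them; the hypothesis on coefficients
makes it vanish. -/
theorem mem_span_coord_image_iff (J : Set (Fin n)) {φ : convSeries n} :
    φ ∈ Ideal.span (coord '' J) ↔ ∀ α : Fin n →₀ ℕ, (∀ j ∈ J, α j = 0) → coeff α φ.1 = 0 := by
  classical
  refine ⟨coeff_eq_zero_of_mem_span_coord, fun h => ?_⟩
  obtain ⟨q, r, hqr, hr⟩ := exists_division (ι := J) (fun j => coord j.1)
    (fun j => Finsupp.single j.1 1) (fun j => coeff_monomial_same _ _)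
    (fun j β hβ => coeff_monomial_ne (fun h => by rw [h] at hβ; exact lt_irrefl _ hβ) _) φ
  have hsum : ∑ j, q j * coord j.1 ∈ Ideal.span (coord '' J) :=
    Ideal.sum_mem _ fun j _ => Ideal.mul_mem_left _ _ (Ideal.subset_span ⟨j.1, j.2, rfl⟩)
  have hr0 : r = 0 := by
    refine Subtype.ext (MvPowerSeries.ext fun β => ?_)
    by_cases hβ : ∀ j ∈ J, β j = 0
    · have h1 : r.1 = φ.1 - (∑ j, q j * coord j.1 : convSeries n).1 := by
        rw [hqr]
        change _ = _ + r.1 - _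
        ring
      rw [h1, map_sub, h β hβ, coeff_eq_zero_of_mem_span_coord hsum β hβ, sub_zero]
      rfl
    · push Not at hβ
      obtain ⟨j, hj, hβj⟩ := hβ
      exact hr ⟨j, hj⟩ β (Finsupp.single_le_iff.2 (Nat.one_le_iff_ne_zero.2 hβj))
  rw [hqr, hr0, add_zero]
  exact hsum

theorem span_range_coord :
    Ideal.span (Set.range (coord (n := n))) = IsLocalRing.maximalIdeal (convSeries n) := by
  ext φ
  rw [← Set.image_univ, mem_span_coord_image_iff, mem_maximalIdeal_convSeries_iff,
    convConstCoeff_apply]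
  refine ⟨fun h => h 0 fun _ _ => rfl, fun h α hα => ?_⟩
  rwa [show α = 0 from Finsupp.ext fun j => hα j trivial]

theorem isWeaklyRegular_coord :
    RingTheory.Sequence.IsWeaklyRegular (convSeries n) (List.ofFn (coord (n := n))) := by
  rw [RingTheory.Sequence.isWeaklyRegular_iff_Fin]
  rintro ⟨i, hi⟩
  rw [List.length_ofFn] at hi
  have hspan : (Ideal.ofList ((List.ofFn (coord (n := n))).take i) • ⊤ :
      Submodule (convSeries n) (convSeries n)) = Ideal.span (coord '' {j : Fin n | (j : ℕ) < i}) := by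
    rw [smul_eq_mul, Ideal.mul_top, Ideal.ofList]
    congr 1
    ext F
    simp only [Set.mem_ofPred_eq, Set.mem_image, List.mem_take_iff_getElem, List.length_ofFn,
      List.getElem_ofFn]
    constructor
    · rintro ⟨j, hj, rfl⟩
      exact ⟨⟨j, by omega⟩, (lt_min_iff.1 hj).1, rfl⟩
    · rintro ⟨j, hj, rfl⟩
      exact ⟨j, lt_min hj j.2, rfl⟩
  rw [isSMulRegular_quotient_iff_mem_of_smul_mem]
  intro φ hφ
  simp only [hspan] at hφ ⊢
  have : (List.ofFn (coord (n := n)))[i]'(by simpa using hi) = coord ⟨i, hi⟩ := by simp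
  change (List.ofFn (coord (n := n)))[i]'(by simpa using hi) * φ ∈ _ at hφ
  rw [this, mem_span_coord_image_iff] at hφ
  rw [mem_span_coord_image_iff]
  intro α hα
  rw [← coeff_add_single_coord_mul ⟨i, hi⟩]
  refine hφ _ fun j hj => ?_
  have hne : (⟨i, hi⟩ : Fin n) ≠ j := by
    rintro rfl
    exact lt_irrefl i hj
  simp [hα j hj, hne]

theorem succ_le_monomialCode (α : Fin n →₀ ℕ) (i : Fin n) : α i + 1 ≤ monomialCode α := by
  refine (Nat.lt_two_pow_self (n := α i)).trans_le ?_
  refine (Nat.pow_le_pow_left (prime_nth i).two_le _).trans (Nat.le_of_dvd (monomialCode_pos α) ?_)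
  exact Finset.dvd_prod_of_mem (fun i : Fin n => Nat.nth Nat.Prime i ^ α i) (Finset.mem_univ i)

/-- The factor γᵢ + 1 produced by differentiation is at most the code of γ, so one more power of the
weight absorbs it. -/
theorem wnorm_pderiv_mul_weight_le (t : ℕ) (i : Fin n) (φ : MvPowerSeries (Fin n) ℂ) :
    wnorm (t + 1) (pderiv ℂ i φ) * weight t (Finsupp.single i 1) ≤ wnorm t φ := by
  rw [wnorm, ← ENNReal.tsum_mul_right]
  refine le_trans (ENNReal.tsum_le_tsum fun γ => ?_)
    (ENNReal.tsum_comp_le_tsum_of_injective (add_left_injective (Finsupp.single i 1))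
      fun β => ‖coeff β φ‖ₑ * weight t β)
  rw [coeff_pderiv, weight_add, enorm_mul, mul_assoc, mul_assoc, ← mul_assoc _ (weight (t + 1) γ)]
  refine mul_le_mul_right (mul_le_mul_left ?_ _) _
  rw [weight, weight, pow_succ', ← mul_assoc]
  refine mul_le_of_le_one_left' ?_
  rw [← div_eq_mul_inv]
  refine ENNReal.div_le_of_le_mul ?_
  rw [one_mul]
  have : ‖(γ i : ℂ) + 1‖ₑ = ((γ i + 1 : ℕ) : ℝ≥0∞) := by
    rw [← Nat.cast_succ, ← ofReal_norm, Complex.norm_natCast, ENNReal.ofReal_natCast]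
  rw [this]
  exact_mod_cast succ_le_monomialCode γ i

theorem pderiv_mem_convSeries (i : Fin n) {φ : MvPowerSeries (Fin n) ℂ} (h : φ ∈ convSeries n) :
    pderiv ℂ i φ ∈ convSeries n := by
  obtain ⟨t, ht⟩ := h
  refine ⟨t + 1, fun h' => ht ?_⟩
  have := wnorm_pderiv_mul_weight_le t i φ
  rwa [h', ENNReal.top_mul (weight_ne_zero _ _), top_le_iff] at this

/-- The partial derivatives of convergent series. -/
noncomputable def convPderiv (i : Fin n) : Derivation ℂ (convSeries n) (convSeries n) :=
  Derivation.mk'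
    { toFun := fun φ => ⟨pderiv ℂ i φ.1, pderiv_mem_convSeries i φ.2⟩
      map_add' := fun φ ψ => Subtype.ext (map_add (pderiv ℂ i) φ.1 ψ.1)
      map_smul' := fun c φ => Subtype.ext ((pderiv ℂ i).map_smul c φ.1) }
    fun φ ψ => Subtype.ext ((pderiv ℂ i).leibniz φ.1 ψ.1)

theorem convPderiv_coord (i j : Fin n) :
    convPderiv i (coord j) = if i = j then 1 else 0 := by
  classical
  apply Subtype.ext
  change pderiv ℂ i (X j) = _
  rw [pderiv_X]
  by_cases h : i = j
  · subst h; simp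
  · simp [h, Ne.symm h]

end ConvergentRing

/-! ### Derivations of a local ring with a field of representatives -/

section Derivations

variable {k A : Type*} [Field k] [CommRing A] [Algebra k A] [IsNoetherianRing A] [IsLocalRing A]
  {n : ℕ}

/-- A derivation of a noetherian local ring with a field of representatives is determined by its
values on generators of the maximal ideal. -/
theorem derivation_eq_zero_of_forall (x : Fin n → A)
    (hx : Ideal.span (Set.range x) = IsLocalRing.maximalIdeal A)
    (hres : ∀ a : A, ∃ c : k, a - algebraMap k A c ∈ IsLocalRing.maximalIdeal A)
    (δ : Derivation k A A) (hδ : ∀ i, δ (x i) = 0) : δ = 0 := by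
  have key : ∀ (m : ℕ) (a : A), δ a ∈ IsLocalRing.maximalIdeal A ^ m := by
    intro m
    induction m with
    | zero => simp
    | succ m ih =>
      intro a
      obtain ⟨c, hc⟩ := hres a
      have h1 : δ a = δ (a - algebraMap k A c) := by simp
      rw [h1]
      rw [← hx] at hc
      -- Since δ kills the xᵢ, δ(a) = ∑ xᵢ δ(yᵢ) gains one power of the maximal ideal; Krull's
      -- intersection theorem concludes.
      obtain ⟨y, hy⟩ := (Submodule.mem_span_range_iff_exists_fun A).1 hc
      rw [← hy, map_sum]
      refine Ideal.sum_mem _ fun i _ => ?_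
      rw [smul_eq_mul, Derivation.leibniz, hδ, smul_zero, zero_add, smul_eq_mul, pow_succ']
      exact Ideal.mul_mem_mul (hx ▸ Ideal.subset_span ⟨i, rfl⟩) (ih _)
  ext a
  have h := Ideal.iInf_pow_eq_bot_of_isLocalRing (IsLocalRing.maximalIdeal A)
    (IsLocalRing.maximalIdeal.isMaximal A).ne_top
  have : δ a ∈ ⨅ i, IsLocalRing.maximalIdeal A ^ i := (Submodule.mem_iInf _).2 fun m => key m a
  rw [h] at this
  exact this

/-- Derivations dual to generators of the maximal ideal form a basis of the module of
derivations. -/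
theorem exists_derivation_basis (x : Fin n → A)
    (hx : Ideal.span (Set.range x) = IsLocalRing.maximalIdeal A)
    (hres : ∀ a : A, ∃ c : k, a - algebraMap k A c ∈ IsLocalRing.maximalIdeal A)
    (d : Fin n → Derivation k A A) (hd : ∀ i j, d i (x j) = if i = j then 1 else 0) :
    ∃ B : Module.Basis (Fin n) A (Derivation k A A), ∀ i, B i = d i := by
  have hap : ∀ (g : Fin n → A) j, (∑ i, g i • d i) (x j) = g j := by
    intro g j
    rw [derivation_sum_apply]
    simp [hd]
  refine ⟨Module.Basis.mk (v := d) ?_ ?_, fun i => Module.Basis.mk_apply _ _ i⟩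
  · rw [Fintype.linearIndependent_iff]
    intro g hg j
    rw [← hap g j, hg, Derivation.zero_apply]
  · intro δ _
    have : δ - ∑ i, δ (x i) • d i = 0 :=
      derivation_eq_zero_of_forall x hx hres _ fun j => by
        rw [Derivation.sub_apply, hap, sub_self]
    rw [sub_eq_zero.1 this]
    exact Submodule.sum_mem _ fun i _ => Submodule.smul_mem _ _ (Submodule.subset_span ⟨i, rfl⟩)

end Derivations

/-! ### Sums of convergent power series -/

section Evaluation

open MvPowerSeries ENNReal Filter

variable {n : ℕ}

/-- The sum of a power series. -/
noncomputable def convEval (φ : MvPowerSeries (Fin n) ℂ) (z : Fin n → ℂ) : ℂ :=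
  ∑' α, coeff α φ * ∏ i, z i ^ α i

/-- The points at which the absolute values of the monomials are their weights. -/
noncomputable def weightPoint (n t : ℕ) (i : Fin n) : ℂ :=
  ((Nat.nth Nat.Prime i : ℂ)⁻¹) ^ t

theorem enorm_prod_weightPoint (t : ℕ) (α : Fin n →₀ ℕ) :
    ‖∏ i, weightPoint n t i ^ α i‖ₑ = weight t α := by
  have h : ∏ i, weightPoint n t i ^ α i = ((monomialCode α : ℂ)⁻¹) ^ t := by
    rw [monomialCode, Nat.cast_prod, ← Finset.prod_inv_distrib, ← Finset.prod_pow]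
    refine Finset.prod_congr rfl fun i _ => ?_
    rw [weightPoint, Nat.cast_pow, ← inv_pow, ← pow_mul, ← pow_mul, mul_comm]
  have h' : ‖(monomialCode α : ℂ)‖ₑ = monomialCode α := by
    rw [← ofReal_norm, Complex.norm_natCast, ENNReal.ofReal_natCast]
  rw [h, enorm_pow, enorm_inv, h', weight]
  exact Nat.cast_ne_zero.2 (monomialCode_pos α).ne'

theorem enorm_prod_pow_le {t : ℕ} {z : Fin n → ℂ} (hz : ∀ i, ‖z i‖ ≤ ‖weightPoint n t i‖)
    (α : Fin n →₀ ℕ) : ‖∏ i, z i ^ α i‖ₑ ≤ weight t α := by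
  rw [← enorm_prod_weightPoint, enorm_le_iff_norm_le, norm_prod, norm_prod]
  refine Finset.prod_le_prod (fun i _ => norm_nonneg _) fun i _ => ?_
  rw [norm_pow, norm_pow]
  exact pow_le_pow_left₀ (norm_nonneg _) (hz i) _

theorem weightPoint_ne_zero (t : ℕ) (i : Fin n) : weightPoint n t i ≠ 0 :=
  pow_ne_zero _ (inv_ne_zero (Nat.cast_ne_zero.2 (prime_nth i).ne_zero))

theorem norm_weightPoint_le (t : ℕ) (i : Fin n) : ‖weightPoint n t i‖ ≤ (2⁻¹ : ℝ) ^ t := by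
  rw [weightPoint, norm_pow, norm_inv, Complex.norm_natCast]
  refine pow_le_pow_left₀ (by positivity) (inv_anti₀ two_pos ?_) _
  exact_mod_cast (prime_nth i).two_le

theorem tendsto_weightPoint : Tendsto (weightPoint n) atTop (𝓝 0) := by
  refine tendsto_pi_nhds.2 fun i => ?_
  refine tendsto_pow_atTop_nhds_zero_of_norm_lt_one ?_
  rw [norm_inv, Complex.norm_natCast]
  exact inv_lt_one_of_one_lt₀ (by exact_mod_cast (prime_nth i).one_lt)

theorem eventually_norm_le_weightPoint (t : ℕ) :
    ∀ᶠ z : Fin n → ℂ in 𝓝 0, ∀ i, ‖z i‖ ≤ ‖weightPoint n t i‖ := by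
  refine eventually_all.2 fun i => ?_
  have h : Tendsto (fun z : Fin n → ℂ => ‖z i‖) (𝓝 0) (𝓝 0) := by
    have : Continuous fun z : Fin n → ℂ => ‖z i‖ := by fun_prop
    simpa using this.tendsto 0
  exact h.eventually (ge_mem_nhds (norm_pos_iff.2 (weightPoint_ne_zero t i)))

theorem summable_norm_of_tsum_enorm_ne_top {ι : Type*} {f : ι → ℂ} (h : ∑' i, ‖f i‖ₑ ≠ ⊤) :
    Summable fun i => ‖f i‖ := by
  simpa using ENNReal.summable_toReal h

theorem tsum_enorm_le_wnorm {t : ℕ} {φ : MvPowerSeries (Fin n) ℂ} {z : Fin n → ℂ}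
    (hz : ∀ i, ‖z i‖ ≤ ‖weightPoint n t i‖) :
    ∑' α, ‖coeff α φ * ∏ i, z i ^ α i‖ₑ ≤ wnorm t φ := by
  refine ENNReal.tsum_le_tsum fun α => ?_
  rw [enorm_mul]
  exact mul_le_mul_right (enorm_prod_pow_le hz α) _

theorem summable_of_wnorm_ne_top {t : ℕ} {φ : MvPowerSeries (Fin n) ℂ} (h : wnorm t φ ≠ ⊤)
    {z : Fin n → ℂ} (hz : ∀ i, ‖z i‖ ≤ ‖weightPoint n t i‖) :
    Summable fun α => ‖coeff α φ * ∏ i, z i ^ α i‖ :=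
  summable_norm_of_tsum_enorm_ne_top (ne_top_of_le_ne_top h (tsum_enorm_le_wnorm hz))

theorem eventually_summable {φ : MvPowerSeries (Fin n) ℂ} (h : φ ∈ convSeries n) :
    ∀ᶠ z : Fin n → ℂ in 𝓝 0, Summable fun α => ‖coeff α φ * ∏ i, z i ^ α i‖ := by
  obtain ⟨t, ht⟩ := h
  filter_upwards [eventually_norm_le_weightPoint t] with z hz
  exact summable_of_wnorm_ne_top ht hz

theorem convEval_add_eventuallyEq (φ ψ : convSeries n) :
    ∀ᶠ z in 𝓝 0, convEval (φ + ψ).1 z = convEval φ.1 z + convEval ψ.1 z := by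
  filter_upwards [eventually_summable φ.2, eventually_summable ψ.2] with z h₁ h₂
  rw [convEval, convEval, convEval, ← h₁.of_norm.tsum_add h₂.of_norm]
  refine tsum_congr fun α => ?_
  change coeff α (φ.1 + ψ.1) * _ = _
  rw [map_add, add_mul]

theorem tsum_mul_tsum_eq_tsum_antidiagonal {f g : (Fin n →₀ ℕ) → ℂ}
    (hf : Summable fun α => ‖f α‖) (hg : Summable fun α => ‖g α‖) :
    (∑' α, f α) * (∑' α, g α) =
      ∑' α, ∑ p ∈ Finset.HasAntidiagonal.antidiagonal α, f p.1 * g p.2 :=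
  hf.of_norm.tsum_mul_tsum_eq_tsum_sum_antidiagonal hg.of_norm (summable_mul_of_summable_norm hf hg)

theorem hasSum_sum_fiber {ι κ : Type*} {f : ι → ℂ} {c : ℂ} (d : ι → κ) (S : κ → Finset ι)
    (hS : ∀ k a, a ∈ S k ↔ d a = k) (h : HasSum f c) : HasSum (fun k => ∑ a ∈ S k, f a) c := by
  have h2 := (Equiv.sigmaFiberEquiv d).hasSum_iff.2 h
  refine h2.sigma fun k => ?_
  have h3 := Finset.hasSum (S k) f
  let e : {a : ι // d a = k} ≃ S k := Equiv.subtypeEquivRight fun a => (hS k a).symm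
  exact e.hasSum_iff.2 h3

theorem hasSum_tsum_fiber {ι κ : Type*} {f : ι → ℂ} (d : ι → κ) (h : Summable f) :
    HasSum (fun k => ∑' a : d ⁻¹' {k}, f a) (∑' a, f a) := by
  have h2 := (Equiv.sigmaFiberEquiv d).hasSum_iff.2 h.hasSum
  exact h2.sigma fun k => (h.subtype (d ⁻¹' {k})).hasSum

theorem coeff_mul_mul_prod_pow (φ ψ : MvPowerSeries (Fin n) ℂ) (z : Fin n → ℂ)
    (α : Fin n →₀ ℕ) :
    coeff α (φ * ψ) * ∏ i, z i ^ α i = ∑ p ∈ Finset.HasAntidiagonal.antidiagonal α,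
      (coeff p.1 φ * ∏ i, z i ^ p.1 i) * (coeff p.2 ψ * ∏ i, z i ^ p.2 i) := by
  rw [coeff_mul, Finset.sum_mul]
  refine Finset.sum_congr rfl fun p hp => ?_
  have hp : p.1 + p.2 = α := Finset.HasAntidiagonal.mem_antidiagonal.1 hp
  rw [← hp, mul_mul_mul_comm, ← Finset.prod_mul_distrib]
  simp only [Finsupp.add_apply, pow_add]

theorem convEval_mul_eventuallyEq (φ ψ : convSeries n) :
    ∀ᶠ z in 𝓝 0, convEval (φ * ψ).1 z = convEval φ.1 z * convEval ψ.1 z := by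
  filter_upwards [eventually_summable φ.2, eventually_summable ψ.2] with z h₁ h₂
  rw [convEval, convEval, convEval, tsum_mul_tsum_eq_tsum_antidiagonal h₁ h₂]
  exact tsum_congr (coeff_mul_mul_prod_pow φ.1 ψ.1 z)

theorem convEval_monomial (α : Fin n →₀ ℕ) (c : ℂ) (z : Fin n → ℂ) :
    convEval (monomial α c) z = c * ∏ i, z i ^ α i := by
  classical
  rw [convEval, tsum_eq_single α, coeff_monomial_same]
  intro β hβ
  rw [coeff_monomial_ne hβ, zero_mul]

theorem convEval_algebraMap (c : ℂ) (z : Fin n → ℂ) :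
    convEval (algebraMap ℂ (convSeries n) c).1 z = c := by
  change convEval (monomial 0 c) z = c
  rw [convEval_monomial]
  simp

/-- The identity theorem for convergent power series. -/
theorem eq_zero_of_convEval_eventuallyEq_zero {φ : convSeries n}
    (h : ∀ᶠ z in 𝓝 0, convEval φ.1 z = 0) : φ = 0 := by
  by_contra hne
  obtain ⟨α, hα, hα0⟩ := exists_initial_exponent (φ := φ.1) fun h => hne (Subtype.ext h)
  set c := coeff α φ.1 with hc
  let ψ : MvPowerSeries (Fin n) ℂ := φ.1 - monomial α c
  have hψ : ψ ∈ convSeries n := sub_mem φ.2 (monomial_mem_convSeries _ _)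
  have hψ0 : ∀ β, monomialCode β ≤ monomialCode α → coeff β ψ = 0 := by
    intro β hβ
    rw [map_sub]
    by_cases e : β = α
    · rw [e, coeff_monomial_same, sub_self]
    · rw [coeff_monomial_ne e, hα0 β (lt_of_le_of_ne hβ fun h' => e (monomialCode_injective h')),
        sub_self]
  have hc0 : ‖c‖ₑ ≠ 0 := enorm_ne_zero.2 hα
  -- At the points `weightPoint n t`, which tend to 0, the initial term has absolute value |c| times
  -- the weight of α, and the other terms add up to at most half of that. The sum cannot vanish
  -- there.
  obtain ⟨t₀, ht₀⟩ := exists_forall_wnorm_le hψ hψ0 (ε := ‖c‖ₑ / 2)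
    (ENNReal.div_ne_zero.2 ⟨hc0, by simp⟩)
  obtain ⟨t₁, ht₁⟩ := exists_forall_wnorm_ne_top hψ
  have hev := (tendsto_weightPoint (n := n)).eventually h
  obtain ⟨t, htz, ht0, ht1⟩ :=
    (hev.and ((eventually_ge_atTop t₀).and (eventually_ge_atTop t₁))).exists
  have hs := summable_of_wnorm_ne_top (ht₁ t ht1) (z := weightPoint n t) fun i => le_rfl
  have h1 : convEval φ.1 (weightPoint n t) =
      convEval ψ (weightPoint n t) + c * ∏ i, weightPoint n t i ^ α i := by
    have hs' : Summable fun β => coeff β (monomial α c) * ∏ i, weightPoint n t i ^ β i := by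
      classical
      refine summable_of_ne_finset_zero (s := {α}) fun β hβ => ?_
      rw [coeff_monomial_ne (by simpa using hβ), zero_mul]
    rw [← convEval_monomial, convEval, convEval, convEval, ← hs.of_norm.tsum_add hs']
    refine tsum_congr fun β => ?_
    rw [← add_mul, ← map_add, sub_add_cancel]
  rw [htz] at h1
  have h2 : ‖c‖ₑ * weight t α ≤ ‖c‖ₑ / 2 * weight t α := by
    calc ‖c‖ₑ * weight t α = ‖convEval ψ (weightPoint n t)‖ₑ := by
          rw [← enorm_prod_weightPoint, ← enorm_mul, ← enorm_neg]
          congr 1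
          linear_combination h1
      _ ≤ wnorm t ψ := enorm_tsum_le_tsum_enorm.trans (tsum_enorm_le_wnorm fun i => le_rfl)
      _ ≤ _ := ht₀ t ht0
  rw [ENNReal.mul_le_mul_iff_left (weight_ne_zero t α) (weight_ne_top t α)] at h2
  exact (ENNReal.half_lt_self hc0 enorm_ne_top).not_ge h2

/-- The monomial is a product of k coordinate projections, listed with multiplicity. In the wrong
degree the zero form is taken, so that a choice exists for all k and α. -/
theorem exists_multilinear_monomial (k : ℕ) (α : Fin n →₀ ℕ) :
    ∃ M : ContinuousMultilinearMap ℂ (fun _ : Fin k => Fin n → ℂ) ℂ, ‖M‖ ≤ 1 ∧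
      (∑ i, α i = k → ∀ z, M (fun _ => z) = ∏ i, z i ^ α i) := by
  by_cases h : ∑ i, α i = k
  swap
  · exact ⟨0, by simp, fun h' => absurd h' h⟩
  let l := (Finsupp.toMultiset α).toList
  have hl : l.length = k := by
    rw [Multiset.length_toList, Finsupp.card_toMultiset, ← h, Finsupp.sum_fintype]
    · rfl
    · simp
  refine ⟨(ContinuousMultilinearMap.mkPiAlgebraFin ℂ k ℂ).compContinuousLinearMap
    fun j => ContinuousLinearMap.proj (l.get (j.cast hl.symm)), ?_, fun _ z => ?_⟩
  · refine (ContinuousMultilinearMap.norm_compContinuousLinearMap_le _ _).trans ?_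
    rw [ContinuousMultilinearMap.norm_mkPiAlgebraFin, one_mul]
    refine Finset.prod_le_one (fun i _ => norm_nonneg _) fun i _ => ?_
    refine ContinuousLinearMap.opNorm_le_bound _ zero_le_one fun z => ?_
    rw [one_mul]
    exact norm_le_pi_norm z _
  · rw [ContinuousMultilinearMap.compContinuousLinearMap_apply,
      ContinuousMultilinearMap.mkPiAlgebraFin_apply]
    have h1 : (List.ofFn fun j : Fin k => z (l.get (j.cast hl.symm))) = l.map z := by
      refine List.ext_getElem (by simp [hl]) fun j _ _ => ?_
      simp
    change (List.ofFn fun j : Fin k => z (l.get (j.cast hl.symm))).prod = _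
    rw [h1, ← Multiset.prod_coe, ← Multiset.map_coe, Multiset.coe_toList,
      Finsupp.toMultiset_map, Finsupp.prod_toMultiset, Finsupp.prod_mapDomain_index]
    · rw [Finsupp.prod_fintype]
      simp
    · simp
    · exact fun _ _ _ => pow_add _ _ _

theorem analyticAt_convEval {φ : MvPowerSeries (Fin n) ℂ} (h : φ ∈ convSeries n) :
    AnalyticAt ℂ (convEval φ) 0 := by
  classical
  obtain ⟨t, ht⟩ := h
  obtain ⟨r, hr, hball⟩ := Metric.eventually_nhds_iff_ball.1
    (eventually_norm_le_weightPoint (n := n) t)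
  choose M hM1 hM using exists_multilinear_monomial (n := n)
  obtain ⟨S, hS⟩ : ∃ S : ℕ → Finset (Fin n →₀ ℕ), ∀ k α, α ∈ S k ↔ ∑ i, α i = k :=
    ⟨fun k => Finset.finsuppAntidiag Finset.univ k, fun k α => by
      simp [Finset.mem_finsuppAntidiag]⟩
  let p : FormalMultilinearSeries ℂ (Fin n → ℂ) ℂ := fun k => ∑ α ∈ S k, coeff α φ • M k α
  have hp : ∀ k z, p k (fun _ => z) = ∑ α ∈ S k, coeff α φ * ∏ i, z i ^ α i := by
    intro k z
    simp only [p, sum_apply, smul_apply]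
    refine Finset.sum_congr rfl fun α hα => ?_
    rw [hM k α ((hS k α).1 hα), smul_eq_mul]
  let ρ : NNReal := ⟨r / 2, by positivity⟩
  -- At a point with all coordinates of absolute value ρ, every monomial of degree k has absolute
  -- value ρ ^ k; absolute convergence there bounds ‖p k‖ ρ ^ k.
  let y : Fin n → ℂ := fun _ => ((r / 2 : ℝ) : ℂ)
  have hρ : ∀ i, ‖y i‖ = ρ := fun i => by
    simp only [y, Complex.norm_real]
    exact Real.norm_of_nonneg (by positivity)
  have hy : ∀ i, ‖y i‖ ≤ ‖weightPoint n t i‖ := by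
    refine hball y ?_
    rw [mem_ball_zero_iff, pi_norm_lt_iff hr]
    intro i
    rw [hρ i]
    exact half_lt_self hr
  have hsum := summable_of_wnorm_ne_top ht hy
  refine ⟨p, ρ, ?_, ?_, ?_⟩
  · refine p.le_radius_of_bound (∑' α, ‖coeff α φ * ∏ i, y i ^ α i‖) fun k => ?_
    calc ‖p k‖ * (ρ : ℝ) ^ k ≤ (∑ α ∈ S k, ‖coeff α φ‖) * (ρ : ℝ) ^ k := by
          refine mul_le_mul_of_nonneg_right ((norm_sum_le _ _).trans ?_) (by positivity)
          refine Finset.sum_le_sum fun α _ => ?_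
          rw [norm_smul]
          exact mul_le_of_le_one_right (norm_nonneg _) (hM1 k α)
      _ = ∑ α ∈ S k, ‖coeff α φ * ∏ i, y i ^ α i‖ := by
          rw [Finset.sum_mul]
          refine Finset.sum_congr rfl fun α hα => ?_
          rw [norm_mul, norm_prod, ← (hS k α).1 hα, ← Finset.prod_pow_eq_pow_sum]
          simp only [norm_pow, hρ]
      _ ≤ _ := hsum.sum_le_tsum _ fun _ _ => norm_nonneg _
  · exact ENNReal.coe_pos.2 (show (0 : ℝ) < r / 2 by positivity)
  · intro z hz
    rw [zero_add]
    have hz' : ∀ i, ‖z i‖ ≤ ‖weightPoint n t i‖ := by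
      refine hball z ?_
      rw [Metric.eball_coe, mem_ball_zero_iff] at hz
      rw [mem_ball_zero_iff]
      exact hz.trans (half_lt_self hr)
    have h1 := (summable_of_wnorm_ne_top ht hz').of_norm.hasSum
    simp only [hp]
    exact hasSum_sum_fiber (fun α : Fin n →₀ ℕ => ∑ i, α i) S hS h1

/-- The exponent of the monomial `∏ⱼ x_{s j}`. -/
noncomputable def seqExponent (s : Σ k, Fin k → Fin n) : Fin n →₀ ℕ :=
  ∑ j, Finsupp.single (s.2 j) 1

theorem prod_pow_seqExponent (s : Σ k, Fin k → Fin n) (z : Fin n → ℂ) :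
    ∏ i, z i ^ seqExponent s i = ∏ j, z (s.2 j) := by
  classical
  have h : ∀ i, z i ^ seqExponent s i = ∏ j, z i ^ (Finsupp.single (s.2 j) 1 i) := by
    intro i
    rw [Finset.prod_pow_eq_pow_sum, seqExponent, Finsupp.coe_finsetSum, Finset.sum_apply]
  simp only [h]
  rw [Finset.prod_comm]
  refine Finset.prod_congr rfl fun j _ => ?_
  rw [Finset.prod_eq_single (s.2 j)]
  · simp
  · intro i _ hi
    simp [hi.symm]
  · simp

theorem multilinear_apply_eq_sum {k : ℕ}
    (p : ContinuousMultilinearMap ℂ (fun _ : Fin k => Fin n → ℂ) ℂ) (z : Fin n → ℂ) :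
    p (fun _ => z) = ∑ s : Fin k → Fin n, p (fun j => Pi.single (s j) 1) * ∏ j, z (s j) := by
  classical
  have h : z = ∑ i, z i • (Pi.single i 1 : Fin n → ℂ) := by
    ext j
    simp [Pi.single_apply]
  conv_lhs => rw [h]
  rw [p.map_sum (fun (_ : Fin k) i => z i • (Pi.single i 1 : Fin n → ℂ))]
  refine Finset.sum_congr rfl fun s _ => ?_
  rw [p.map_smul_univ (fun j => z (s j)) fun j => (Pi.single (s j) 1 : Fin n → ℂ), smul_eq_mul,
    mul_comm]

/-- Analytic functions are sums of convergent power series. -/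
theorem exists_convEval_eventuallyEq {f : (Fin n → ℂ) → ℂ} (hf : AnalyticAt ℂ f 0) :
    ∃ φ : convSeries n, ∀ᶠ z in 𝓝 0, f z = convEval φ.1 z := by
  classical
  obtain ⟨p, r, hp⟩ := hf
  let a : (Σ k, Fin k → Fin n) → ℂ := fun s => p s.1 fun j => Pi.single (s.2 j) 1
  have ha : ∀ s, ‖a s‖ₑ ≤ ‖p s.1‖ₑ := by
    intro s
    rw [enorm_le_iff_norm_le]
    refine ((p s.1).le_opNorm _).trans (mul_le_of_le_one_right (norm_nonneg _) ?_)
    refine Finset.prod_le_one (fun j _ => norm_nonneg _) fun j _ => ?_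
    rw [Pi.norm_single, norm_one]
  -- There are n ^ k words of length k, each of weight at most (2⁻¹ ^ t) ^ k; hence the factor n.
  obtain ⟨t, ht⟩ : ∃ t : ℕ, ((n * 2⁻¹ ^ t : NNReal) : ℝ≥0∞) < p.radius := by
    have hlim : Tendsto (fun t : ℕ => ((n * 2⁻¹ ^ t : NNReal) : ℝ≥0∞)) atTop (𝓝 0) := by
      rw [← ENNReal.coe_zero, ENNReal.tendsto_coe]
      have := (NNReal.tendsto_pow_atTop_nhds_zero_of_lt_one (r := (2⁻¹ : NNReal))
        (by norm_num)).const_mul (n : NNReal)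
      simpa using this
    exact (hlim.eventually (gt_mem_nhds (hp.r_pos.trans_le hp.r_le))).exists
  have hK : ∑' s : Σ k, Fin k → Fin n, ‖a s‖ₑ * weight t (seqExponent s) ≠ ⊤ := by
    have h1 : ∑' k, ‖p k‖ₑ * ((n * 2⁻¹ ^ t : NNReal) : ℝ≥0∞) ^ k ≠ ⊤ := by
      have h := p.summable_norm_mul_pow ht
      have h' : ∀ k, ‖p k‖ₑ * ((n * 2⁻¹ ^ t : NNReal) : ℝ≥0∞) ^ k =
          ENNReal.ofReal (‖p k‖ * ((n * 2⁻¹ ^ t : NNReal) : ℝ) ^ k) := by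
        intro k
        rw [ENNReal.ofReal_mul (norm_nonneg _), ofReal_norm,
          ENNReal.ofReal_pow (NNReal.coe_nonneg _), ENNReal.ofReal_coe_nnreal]
      simp only [h']
      exact h.tsum_ofReal_ne_top
    refine ne_top_of_le_ne_top h1 ?_
    rw [ENNReal.tsum_sigma']
    refine ENNReal.tsum_le_tsum fun k => ?_
    rw [tsum_fintype]
    have h2 : ∀ s : Fin k → Fin n, ‖a ⟨k, s⟩‖ₑ * weight t (seqExponent ⟨k, s⟩) ≤
        ‖p k‖ₑ * ((2⁻¹ ^ t : NNReal) : ℝ≥0∞) ^ k := by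
      intro s
      refine mul_le_mul' (ha ⟨k, s⟩) ?_
      rw [← enorm_prod_weightPoint, prod_pow_seqExponent, ← ENNReal.coe_pow, enorm_le_coe,
        ← NNReal.coe_le_coe, coe_nnnorm, norm_prod]
      refine (Finset.prod_le_prod (fun j _ => norm_nonneg _)
        fun j _ => norm_weightPoint_le t (s j)).trans_eq ?_
      simp
    refine (Finset.sum_le_sum fun s _ => h2 s).trans_eq ?_
    simp [mul_pow]
    ring
  -- Words in the coordinates with the same exponent are collected into a single coefficient.
  let φ : MvPowerSeries (Fin n) ℂ := fun α => ∑' s : seqExponent ⁻¹' {α}, a s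
  have hφc : ∀ α, coeff α φ = ∑' s : seqExponent ⁻¹' {α}, a s := fun α => rfl
  have hφ : φ ∈ convSeries n := by
    refine ⟨t, ne_top_of_le_ne_top hK ?_⟩
    rw [← ENNReal.tsum_fiberwise _ seqExponent]
    refine ENNReal.tsum_le_tsum fun α => ?_
    rw [hφc]
    refine (mul_le_mul_left enorm_tsum_le_tsum_enorm _).trans_eq ?_
    rw [← ENNReal.tsum_mul_right]
    refine tsum_congr fun s => ?_
    rw [show seqExponent s.1 = α from s.2]
  refine ⟨⟨φ, hφ⟩, ?_⟩
  filter_upwards [eventually_norm_le_weightPoint t, Metric.eball_mem_nhds 0 hp.r_pos] with z hz hzr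
  have hs : Summable fun s : Σ k, Fin k → Fin n => a s * ∏ j, z (s.2 j) := by
    refine (summable_norm_of_tsum_enorm_ne_top (ne_top_of_le_ne_top hK ?_)).of_norm
    refine ENNReal.tsum_le_tsum fun s => ?_
    rw [enorm_mul, ← prod_pow_seqExponent]
    exact mul_le_mul_right (enorm_prod_pow_le hz _) _
  have h1 : HasSum (fun k => p k fun _ => z) (∑' s : Σ k, Fin k → Fin n, a s * ∏ j, z (s.2 j)) := by
    refine hs.hasSum.sigma fun k => ?_
    rw [multilinear_apply_eq_sum]
    exact hasSum_fintype _
  have h2 := hp.hasSum hzr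
  rw [zero_add] at h2
  rw [h2.unique h1, convEval]
  refine HasSum.tsum_eq ?_ |>.symm
  convert hasSum_tsum_fiber seqExponent hs using 2 with α
  rw [hφc, ← tsum_mul_right]
  refine tsum_congr fun s => ?_
  rw [← prod_pow_seqExponent, show seqExponent s.1 = α from s.2]

end Evaluation

/-! ### Germs of holomorphic functions -/

section Germs

open Filter

variable {n : ℕ} {X : Type*} [TopologicalSpace X] [ChartedSpace (Fin n → ℂ) X]

/-- The chart of the manifold at `p`, centered at `p`. -/
noncomputable def centeredChart (p x : X) : Fin n → ℂ :=
  extChartAt 𝓘(ℂ, Fin n → ℂ) p x - extChartAt 𝓘(ℂ, Fin n → ℂ) p p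

theorem map_centeredChart (p : X) : map (centeredChart (n := n) p) (𝓝 p) = 𝓝 0 := by
  have h := map_extChartAt_nhds_of_boundaryless (I := 𝓘(ℂ, Fin n → ℂ)) p
  have h2 : centeredChart (n := n) p =
      (fun z => z - extChartAt 𝓘(ℂ, Fin n → ℂ) p p) ∘ extChartAt 𝓘(ℂ, Fin n → ℂ) p := rfl
  rw [h2, ← Filter.map_map, h]
  simp

theorem eventually_centeredChart_iff (p : X) (P : (Fin n → ℂ) → Prop) :
    (∀ᶠ x in 𝓝 p, P (centeredChart p x)) ↔ ∀ᶠ z in 𝓝 0, P z := by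
  rw [← map_centeredChart p, eventually_map]

theorem holomorphicNear_comp_centeredChart (p : X) {F : (Fin n → ℂ) → ℂ}
    (hF : AnalyticAt ℂ F 0) : HolomorphicNear n p fun x => F (centeredChart p x) := by
  have h1 : ContMDiffAt 𝓘(ℂ, Fin n → ℂ) 𝓘(ℂ, Fin n → ℂ) ω (centeredChart (n := n) p) p :=
    contMDiffAt_extChartAt.sub contMDiffAt_const
  have h2 : centeredChart (n := n) p p = 0 := sub_self _
  have h3 : ContMDiffAt 𝓘(ℂ, Fin n → ℂ) 𝓘(ℂ) ω F (centeredChart p p) := by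
    rw [h2]
    exact hF.contDiffAt.contMDiffAt
  exact h3.comp p h1

theorem HolomorphicNear.exists_analyticAt {p : X} {f : X → ℂ} (hf : HolomorphicNear n p f) :
    ∃ F : (Fin n → ℂ) → ℂ, AnalyticAt ℂ F 0 ∧ ∀ᶠ x in 𝓝 p, f x = F (centeredChart p x) := by
  let c := extChartAt 𝓘(ℂ, Fin n → ℂ) p
  refine ⟨fun z => f (c.symm (z + c p)), ?_, ?_⟩
  · have h := (contMDiffAt_iff.1 hf).2
    rw [ModelWithCorners.range_eq_univ, contDiffWithinAt_univ] at h
    have h' : AnalyticAt ℂ (f ∘ c.symm) ((fun z : Fin n → ℂ => z + c p) 0) := by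
      change AnalyticAt ℂ _ (0 + c p)
      rw [zero_add]
      exact h.analyticAt
    have h2 : AnalyticAt ℂ (fun z : Fin n → ℂ => z + c p) 0 := analyticAt_id.add analyticAt_const
    exact AnalyticAt.comp (f := fun z : Fin n → ℂ => z + c p) h' h2
  · filter_upwards [extChartAt_source_mem_nhds (I := 𝓘(ℂ, Fin n → ℂ)) p] with x hx
    change f x = f (c.symm (c x - c p + c p))
    rw [sub_add_cancel, c.left_inv hx]

/-- The germ at `p` of the sum of a convergent power series in the coordinates of the chart. -/
noncomputable def germOfSeries (p : X) (φ : convSeries n) : holGerms n p :=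
  ⟨((fun x => convEval φ.1 (centeredChart p x) : X → ℂ) : Germ (𝓝 p) ℂ), _,
    holomorphicNear_comp_centeredChart p (analyticAt_convEval φ.2), rfl⟩

/-- The germs of sums of convergent power series, as a morphism of algebras. -/
noncomputable def germOfSeriesHom (p : X) : convSeries n →ₐ[ℂ] holGerms n p where
  toFun := germOfSeries p
  map_one' := by
    refine Subtype.ext (Germ.coe_eq.2 (Eventually.of_forall fun x => ?_))
    have := convEval_algebraMap (n := n) 1 (centeredChart p x)
    rwa [map_one] at this
  map_zero' := by
    refine Subtype.ext (Germ.coe_eq.2 (Eventually.of_forall fun x => ?_))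
    have := convEval_algebraMap (n := n) 0 (centeredChart p x)
    rwa [map_zero] at this
  map_add' φ ψ := Subtype.ext (Germ.coe_eq.2 ((eventually_centeredChart_iff p
    fun z => convEval (φ + ψ).1 z = convEval φ.1 z + convEval ψ.1 z).2
      (convEval_add_eventuallyEq φ ψ)))
  map_mul' φ ψ := Subtype.ext (Germ.coe_eq.2 ((eventually_centeredChart_iff p
    fun z => convEval (φ * ψ).1 z = convEval φ.1 z * convEval ψ.1 z).2
      (convEval_mul_eventuallyEq φ ψ)))
  commutes' c := Subtype.ext (Germ.coe_eq.2 (Eventually.of_forall fun x =>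
    convEval_algebraMap (n := n) c (centeredChart p x)))

/-- Injectivity is the identity theorem, surjectivity the Taylor expansion in the centered chart. -/
theorem germOfSeriesHom_bijective (p : X) :
    Function.Bijective (germOfSeriesHom (n := n) p) := by
  constructor
  · rw [injective_iff_map_eq_zero]
    intro φ hφ
    refine eq_zero_of_convEval_eventuallyEq_zero ?_
    rw [← eventually_centeredChart_iff p]
    exact Germ.coe_eq.1 (Subtype.ext_iff.1 hφ)
  · rintro ⟨_, f, hf, rfl⟩
    obtain ⟨F, hF, hfF⟩ := hf.exists_analyticAt
    obtain ⟨φ, hφ⟩ := exists_convEval_eventuallyEq hF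
    refine ⟨φ, Subtype.ext (Germ.coe_eq.2 ?_)⟩
    rw [← eventually_centeredChart_iff p] at hφ
    filter_upwards [hφ, hfF] with x h1 h2
    rw [h2, h1]

/-- The ring of germs at `p` is isomorphic to the ring of convergent power series. -/
noncomputable def seriesEquivGerms (p : X) : convSeries n ≃ₐ[ℂ] holGerms n p :=
  AlgEquiv.ofBijective (germOfSeriesHom p) (germOfSeriesHom_bijective p)

end Germs

/-! ### Regularity of the symbols -/

section Koszul

open RingTheory.Sequence MvPolynomial

/-- Let `A` be a noetherian local domain with a regular system of parameters `x` and dual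
derivations `d`. If the jacobian ideal of `h` is of linear type and the module of logarithmic
derivations is free, then the symbols of a basis of it form a regular sequence. -/
theorem isRegular_symbol_of_isOfLinearType {k A : Type*} [Field k] [CommRing A] [Algebra k A]
    [IsNoetherianRing A] [IsLocalRing A] [IsDomain A] [CharZero A] {n : ℕ} (x : Fin n → A)
    (hx : Ideal.span (Set.range x) = IsLocalRing.maximalIdeal A)
    (hxr : IsWeaklyRegular A (List.ofFn x))
    (hres : ∀ a : A, ∃ c : k, a - algebraMap k A c ∈ IsLocalRing.maximalIdeal A)
    (d : Fin n → Derivation k A A) (hd : ∀ i j, d i (x j) = if i = j then 1 else 0)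
    {h : A} (hh : h ≠ 0) (hlin : IsOfLinearType (jacobianIdeal k h))
    {I : Ideal A} (hI : I = Ideal.span {h}) (b : Module.Basis (Fin n) A (logDer k I)) :
    IsRegular (Gr k A) (List.ofFn fun i => symbol (b i).1) := by
  subst hI
  obtain ⟨B, hB⟩ := exists_derivation_basis x hx hres d hd
  have hα : ∀ j, ∃ a, (b j).1 h = a * h := fun j => by
    obtain ⟨a, ha⟩ := Ideal.mem_span_singleton'.1
      ((b j).2 h (Ideal.mem_span_singleton_self h))
    exact ⟨a, ha.symm⟩
  choose α hα using hα
  let σ : Fin n → MvPolynomial (Fin n) A := fun j => ∑ i, C (B.repr (b j).1 i) * X i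
  have hσ : ∀ j, (σ j).IsHomogeneous 1 := fun j =>
    IsHomogeneous.sum _ _ _ fun i _ => by
      simpa using (isHomogeneous_C (Fin n) (B.repr (b j).1 i)).mul (isHomogeneous_X A i)
  have hreg : IsWeaklyRegular (MvPolynomial (Fin n) A) (List.ofFn σ) := by
    refine isWeaklyRegular_of_ker_reesPresentation_le x hx hxr hh _ _
      (ker_reesPresentation_le_span B hh hlin b α hα) σ hσ fun j => ?_
    simp [σ, MvPolynomial.algebraMap_eq]
  have hbij : Function.Bijective (symbolHom d) := by
    refine ⟨symbolHom_injective d x hd, symbolHom_surjective d ?_⟩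
    rw [← funext hB]
    exact B.span_eq
  let e : MvPolynomial (Fin n) A ≃+* Gr k A := RingEquiv.ofBijective _ hbij
  have he : ∀ j, e (σ j) = symbol (b j).1 := fun j => by
    change symbolHom d (σ j) = _
    conv_rhs => rw [← B.sum_repr (b j).1]
    rw [symbol_sum]
    simp [σ, symbolHom, symbol_smul, hB]
  have hforall : List.Forall₂ (fun r s => ∀ F, e.toAddEquiv (r • F) = s • e.toAddEquiv F)
      (List.ofFn σ) (List.ofFn fun i => symbol (b i).1) := by
    refine List.forall₂_iff_get.2 ⟨by simp, fun i h₁ h₂ F => ?_⟩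
    simp only [List.get_ofFn, ← he]
    exact map_mul e _ _
  refine (e.toAddEquiv.isRegular_congr hforall).1 ⟨hreg, ?_⟩
  -- The σⱼ have no constant term, so they do not generate the unit ideal.
  intro htop
  have hle : Ideal.ofList (List.ofFn σ) ≤ RingHom.ker (constantCoeff (σ := Fin n) (R := A)) := by
    refine Ideal.span_le.2 fun F hF => ?_
    obtain ⟨j, rfl⟩ := List.mem_ofFn.1 hF
    simp [RingHom.mem_ker, σ]
  have h1 : (1 : MvPolynomial (Fin n) A) ∈ Ideal.ofList (List.ofFn σ) := by
    have : (1 : MvPolynomial (Fin n) A) ∈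
        (Ideal.ofList (List.ofFn σ) • ⊤ : Submodule (MvPolynomial (Fin n) A) _) :=
      htop ▸ Submodule.mem_top
    rwa [smul_eq_mul, Ideal.mul_top] at this
  simpa [RingHom.mem_ker] using hle h1

end Koszul

/-! ### Transport to rings isomorphic to the ring of convergent power series -/

section Transport

open RingTheory.Sequence

/-- The derivation obtained by transport along an isomorphism of algebras. -/
noncomputable def derivationCongr {k A B : Type*} [CommRing k] [CommRing A] [CommRing B]
    [Algebra k A] [Algebra k B] (e : A ≃ₐ[k] B) (δ : Derivation k A A) : Derivation k B B :=
  Derivation.mk' (e.toLinearMap ∘ₗ (δ : A →ₗ[k] A) ∘ₗ e.symm.toLinearMap) fun a b => by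
    simp

theorem derivationCongr_apply {k A B : Type*} [CommRing k] [CommRing A] [CommRing B]
    [Algebra k A] [Algebra k B] (e : A ≃ₐ[k] B) (δ : Derivation k A A) (b : B) :
    derivationCongr e δ b = e (δ (e.symm b)) := rfl

/-- The symbols of a basis of the logarithmic derivations, in an algebra isomorphic to the algebra
of convergent power series. -/
theorem isRegular_symbol_of_algEquiv {n : ℕ} {A : Type*} [CommRing A] [Algebra ℂ A]
    (e : convSeries n ≃ₐ[ℂ] A) {h : A} (hh : h ≠ 0) (hlin : IsOfLinearType (jacobianIdeal ℂ h))
    {I : Ideal A} (hI : I = Ideal.span {h}) (b : Module.Basis (Fin n) A (logDer ℂ I)) :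
    IsRegular (Gr ℂ A) (List.ofFn fun i => symbol (b i).1) := by
  have : IsNoetherianRing A := isNoetherianRing_of_ringEquiv _ e.toRingEquiv
  have : IsLocalRing A := e.toRingEquiv.isLocalRing
  have : IsDomain (MvPowerSeries (Fin n) ℂ) := NoZeroDivisors.to_isDomain _
  have : IsDomain A := e.symm.toMulEquiv.isDomain (convSeries n)
  have : CharZero A := charZero_of_injective_algebraMap (algebraMap ℂ A).injective
  have hmax : (IsLocalRing.maximalIdeal (convSeries n)).map e.toRingEquiv =
      IsLocalRing.maximalIdeal A := by
    ext a
    rw [← Ideal.comap_symm, Ideal.mem_comap, IsLocalRing.mem_maximalIdeal,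
      IsLocalRing.mem_maximalIdeal, mem_nonunits_iff, mem_nonunits_iff, MulEquiv.isUnit_map]
  refine isRegular_symbol_of_isOfLinearType (fun i => e (coord i)) ?_ ?_ ?_
    (fun i => derivationCongr e (convPderiv i)) ?_ hh hlin hI b
  · rw [← hmax, ← span_range_coord, Ideal.map_span, ← Set.range_comp]
    rfl
  · refine (e.toRingEquiv.toAddEquiv.isWeaklyRegular_congr ?_).1 (isWeaklyRegular_coord (n := n))
    refine List.forall₂_iff_get.2 ⟨by simp, fun i h₁ h₂ F => ?_⟩
    simp only [List.get_ofFn]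
    exact map_mul e _ _
  · intro a
    refine ⟨convConstCoeff (e.symm a), ?_⟩
    rw [← hmax, ← Ideal.comap_symm, Ideal.mem_comap, mem_maximalIdeal_convSeries_iff]
    change convConstCoeff (e.symm (a - algebraMap ℂ A _)) = 0
    rw [map_sub, map_sub, AlgEquiv.commutes, convConstCoeff_algebraMap, sub_self]
  · intro i j
    rw [derivationCongr_apply, e.symm_apply_apply, convPderiv_coord]
    split_ifs <;> simp

end Transport

section Geometry

variable {n : ℕ} {X : Type*} [TopologicalSpace X] [ChartedSpace (Fin n → ℂ) X]

/-- A reduced equation of a hypersurface is not zero. -/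
theorem IsReducedEquation.ne_zero {D : Set X} (hD : IsHypersurface n D) {p : X} (hp : p ∈ D)
    {h : holGerms n p} (hh : IsReducedEquation n D p h) : h ≠ 0 := by
  rintro rfl
  obtain ⟨f, hf, hf0, hfD⟩ := hD.exists_equation p hp
  have hmem : (⟨f, f, hf, rfl⟩ : holGerms n p) ∈ vanishingIdeal n D p :=
    ⟨f, rfl, hfD.mono fun x hx => hx.1⟩
  have hspan : vanishingIdeal n D p = Ideal.span {0} := hh
  rw [hspan, Ideal.mem_span_singleton, zero_dvd_iff] at hmem
  exact hf0 (Filter.Germ.coe_eq.1 (Subtype.ext_iff.1 hmem))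

end Geometry

end LogGeom

theorem mainTheorem11 {n : ℕ} {X : Type*} [TopologicalSpace X] [ChartedSpace (Fin n → ℂ) X]
    [IsManifold 𝓘(ℂ, Fin n → ℂ) ω X] (D : Set X) (hD : LogGeom.IsHypersurface n D)
    (p : X) (hp : p ∈ D) (hfree : LogGeom.IsFreeAt n D p)
    (hlin : LogGeom.IsOfLinearJacobianTypeAt n D p) :
    LogGeom.IsKoszulFreeAt n D p := by
  obtain ⟨h, hh, hlin⟩ := hlin
  exact ⟨hfree, fun b => LogGeom.isRegular_symbol_of_algEquiv (LogGeom.seriesEquivGerms p)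
    (hh.ne_zero hD hp) hlin hh b⟩
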